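/- Let $N,T>0$ and let $l:[0,\infty)\to[0,1]$ be continuous, strictly decreasing on its support, with $\int_0^\infty x\,l(x)\,dx<\infty$; assume that $l(x)>0$ for all $x\ge 0$. For a point process (random locally finite counting measure) $\Phi$ in $\mathbb R^2$ put $I_\Phi(y)=\sum_{X\in\Phi\setminus\{y\}}l(|X-y|)$, and for $P,\gamma>0$ $$\mathrm{SINR}(x,y,\Phi,\gamma)=\frac{P\,l(|x-y|)}{N+\gamma P\,I_{\Phi\setminus\{x\}}(y)} .$$ Given point processes $\Phi_B$ (back-bone) and $\Phi_I$ (interferers) in $\mathbb R^2$, defined on one probability space with arbitrary dependence, let $G(\Phi_B,\Phi_I,\gamma)$ be the graph with the points of $\Phi_B$ as nodes and an edge between distinct nodes $X,Y$ whenever $\mathrm{SINR}(X,Y,\Phi_I,\gamma)>T$ and $\mathrm{SINR}(Y,X,\Phi_I,\gamma)>T$. A function $f:\mathbb R^n\to\mathbb R$ is directionally convex ($dcx$) if $f(x)+f(y)\le f(p)+f(q)$ whenever $p\le x,y\le q$ componentwise and $x+y=p+q$; it is $idcx$ (resp. $ddcx$) if it is moreover nondecreasing (resp. nonincreasing). For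 point processes, $\Phi_1\le_{idcx}\Phi_2$ (resp. $\Phi_1\le_{ddcx}\Phi_2$) means that for all $n$, all bounded Borel sets $B_1,\dots,B_n$ and every $idcx$ (resp. $ddcx$) function $f$ for which both expectations are finite, $\mathbb E f(\Phi_1(B_1),\dots,\Phi_1(B_n))\le\mathbb E f(\Phi_2(B_1),\dots,\Phi_2(B_n))$. Let $\Phi_\lambda$, $\Phi_\mu$ be homogeneous Poisson point processes in $\mathbb R^2$ of intensities $\lambda,\mu>0$. Suppose that $\Phi_B\le_{ddcx}\Phi_\lambda$, that $\Phi_I\le_{idcx}\Phi_\mu$, and that $\mathbb E[\Phi_I(B)]<\infty$ for every bounded Borel set $B$. Then there exist a signal power $P>0$ with $l(0)\ge TN/P$ and an interference factor $\gamma>0$ such that almost surely the SINR graph $G(\Phi_B,\Phi_I,\gamma)$ percolates, i.e. has an infinite connected component. -/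

import Mathlib

open MeasureTheory ProbabilityTheory
open scoped NNReal ENNReal

noncomputable section

/-- The Euclidean plane `ℝ²`. -/
abbrev Plane : Type := EuclideanSpace ℝ (Fin 2)

/-! ### Directionally convex functions and the orders they generate -/

/-- A function on `ℝⁿ` is directionally convex (dcx) if `f x + f y ≤ f p + f q` whenever
`p ≤ x, y ≤ q` componentwise and `x + y = p + q`. -/
def IsDcx {n : ℕ} (f : (Fin n → ℝ) → ℝ) : Prop :=
  ∀ x y p q : Fin n → ℝ, p ≤ x → x ≤ q → p ≤ y → y ≤ q → x + y = p + q →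
    f x + f y ≤ f p + f q

/-- Increasing (i.e. nondecreasing) dcx functions. -/
def IsIdcx {n : ℕ} (f : (Fin n → ℝ) → ℝ) : Prop := IsDcx f ∧ Monotone f

/-- Decreasing (i.e. nonincreasing) dcx functions. -/
def IsDdcx {n : ℕ} (f : (Fin n → ℝ) → ℝ) : Prop := IsDcx f ∧ Antitone f

/-- The integral stochastic order of random vectors (possibly on different probability spaces)
generated by a class `C` of functions: `𝔼 f(X) ≤ 𝔼 f(Y)` for each `f` in the class for which both
expectations are finite. -/
def VecLE {n : ℕ} (C : ((Fin n → ℝ) → ℝ) → Prop)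
    {Ω₁ Ω₂ : Type*} [MeasurableSpace Ω₁] [MeasurableSpace Ω₂]
    (Pr₁ : Measure Ω₁) (X : Ω₁ → Fin n → ℝ) (Pr₂ : Measure Ω₂) (Y : Ω₂ → Fin n → ℝ) : Prop :=
  ∀ f : (Fin n → ℝ) → ℝ, C f →
    Integrable (fun ω => f (X ω)) Pr₁ → Integrable (fun ω => f (Y ω)) Pr₂ →
      ∫ ω, f (X ω) ∂Pr₁ ≤ ∫ ω, f (Y ω) ∂Pr₂

/-! ### Point processes in the plane -/

/-- A point process in the plane: a random locally finite counting measure, that is, a random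
measure that gives every bounded Borel set a (finite) natural number of points. -/
structure IsPointProcess {Ω : Type*} [MeasurableSpace Ω] (Φ : Ω → Measure Plane) : Prop where
  measurable : Measurable Φ
  count_nat : ∀ ω, ∀ B : Set Plane, MeasurableSet B → Bornology.IsBounded B →
    ∃ k : ℕ, Φ ω B = k

/-- `Φ` is a homogeneous Poisson point process of intensity `lam` under `Pr`: the number of points
in a bounded Borel set `B` has the Poisson law with mean `lam * |B|`, and the numbers of points in
finitely many pairwise disjoint bounded Borel sets are independent. -/
structure IsPoissonProcess {Ω : Type*} [MeasurableSpace Ω] (Pr : Measure Ω)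
    (Φ : Ω → Measure Plane) (lam : ℝ≥0) : Prop extends IsPointProcess Φ where
  law_count : ∀ B : Set Plane, MeasurableSet B → Bornology.IsBounded B →
    Pr.map (fun ω => Φ ω B) =
      (poissonMeasure (lam * (volume B).toNNReal)).map (fun k : ℕ => (k : ℝ≥0∞))
  indep_count : ∀ (n : ℕ) (B : Fin n → Set Plane),
    (∀ i, MeasurableSet (B i)) → (∀ i, Bornology.IsBounded (B i)) →
    Pairwise (fun i j => Disjoint (B i) (B j)) → iIndepFun (fun i ω => Φ ω (B i)) Pr

/-- The vector of the numbers of points in `B 0, …, B (n - 1)`. -/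
def countVec {Ω : Type*} (Φ : Ω → Measure Plane) {n : ℕ} (B : Fin n → Set Plane) (ω : Ω) :
    Fin n → ℝ :=
  fun i => (Φ ω (B i)).toReal

/-- `Φ₁ ≤_idcx Φ₂` for point processes: the idcx order of the vectors of numbers of points in any
finitely many bounded Borel sets. -/
def PPLeIdcx {Ω₁ Ω₂ : Type*} [MeasurableSpace Ω₁] [MeasurableSpace Ω₂]
    (Pr₁ : Measure Ω₁) (Φ₁ : Ω₁ → Measure Plane)
    (Pr₂ : Measure Ω₂) (Φ₂ : Ω₂ → Measure Plane) : Prop :=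
  ∀ (n : ℕ) (B : Fin n → Set Plane),
    (∀ i, MeasurableSet (B i)) → (∀ i, Bornology.IsBounded (B i)) →
      VecLE IsIdcx Pr₁ (countVec Φ₁ B) Pr₂ (countVec Φ₂ B)

/-- `Φ₁ ≤_ddcx Φ₂` for point processes: the ddcx order of the vectors of numbers of points in any
finitely many bounded Borel sets. -/
def PPLeDdcx {Ω₁ Ω₂ : Type*} [MeasurableSpace Ω₁] [MeasurableSpace Ω₂]
    (Pr₁ : Measure Ω₁) (Φ₁ : Ω₁ → Measure Plane)
    (Pr₂ : Measure Ω₂) (Φ₂ : Ω₂ → Measure Plane) : Prop :=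
  ∀ (n : ℕ) (B : Fin n → Set Plane),
    (∀ i, MeasurableSet (B i)) → (∀ i, Bornology.IsBounded (B i)) →
      VecLE IsDdcx Pr₁ (countVec Φ₁ B) Pr₂ (countVec Φ₂ B)

/-! ### The SINR graph -/

/-- The conditions on the attenuation function `l(r)`, `r ≥ 0`, that do not involve the signal
power (only the values of `l` on `[0, ∞)` matter). -/
structure IsAttenuation (l : ℝ → ℝ) : Prop where
  nonneg : ∀ r, 0 ≤ r → 0 ≤ l r
  le_one : ∀ r, 0 ≤ r → l r ≤ 1
  continuousOn : ContinuousOn l (Set.Ici 0)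
  strictAntiOn : StrictAntiOn l (Set.Ici 0 ∩ Function.support l)
  integrableOn : IntegrableOn (fun r => r * l r) (Set.Ioi 0)

/-- The unit-power interference `I_ν(y) = ∑ l(|X - y|)`, summed over the points `X ≠ y` of the
counting measure `ν`; its value may be `∞`. -/
def interference (l : ℝ → ℝ) (ν : Measure Plane) (y : Plane) : ℝ≥0∞ :=
  ∫⁻ z in {y}ᶜ, ENNReal.ofReal (l (dist z y)) ∂ν

/-- `SINR(x, y, ν, γ) = P l(|x - y|) / (N + γ P I_{ν ∖ {x}}(y))`; it is `0` when the interference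
is infinite and `γ, P > 0`. -/
def sinr (l : ℝ → ℝ) (P N γ : ℝ) (ν : Measure Plane) (x y : Plane) : ℝ≥0∞ :=
  ENNReal.ofReal (P * l (dist x y)) /
    (ENNReal.ofReal N + ENNReal.ofReal (γ * P) * interference l (ν.restrict {x}ᶜ) y)

/-- The SINR graph with back-bone `β` and interferers `ν`: its nodes are the points (atoms) of the
counting measure `β`, and two nodes are joined when the SINR exceeds `T` in both directions. -/
def sinrGraph (l : ℝ → ℝ) (P N T γ : ℝ) (β ν : Measure Plane) :
    SimpleGraph {x : Plane // β {x} ≠ 0} where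
  Adj x y := x ≠ y ∧ ENNReal.ofReal T < sinr l P N γ ν y x ∧
    ENNReal.ofReal T < sinr l P N γ ν x y
  symm := ⟨fun _ _ h => ⟨h.1.symm, h.2.2, h.2.1⟩⟩
  loopless := ⟨fun _ h => h.1 rfl⟩

/-- A graph percolates if it has an infinite connected component. -/
def Percolates {V : Type*} (G : SimpleGraph V) : Prop :=
  ∃ c : G.ConnectedComponent, c.supp.Infinite

end

/-! The proof discretizes the plane into square cells of side `s` and runs a Peierls argument. A
cell is good if it contains a back-bone point and its total interference bound is at most `K`.
Points of neighbouring good cells are within `4 * s`, so `P = 4TN / l(4s)` makes the signal at least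
`4TN`, and `γ = N / (PK)` makes noise plus interference at most `2N`. The SINR is then at least
`2T`, so an infinite cluster of good cells yields an infinite component (`lt_sinr`,
`percolates_of_infinite_cluster`).

It remains to show that `k` given cells are all bad with probability at most `18 ^ (-k)`. Emptiness
is controlled by the ddcx function `max 0 (1 - x)`, which is the void indicator on counts
(`measure_void_le`). If the interference is large in all `k` cells, so is its sum over them, a
weighted count of interferers. An idcx function of this count is compared with Poisson exponential
moments (`measure_forall_lt_cellInterference_le`). Dependence between the two processes is harmless:
at least half of the bad cells are bad for the same reason (`measure_forall_or_le`).

If all good clusters are finite, arbitrarily long diagonal paths of bad cells cross the axis near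
the origin. Their expected number decays like `9 ^ n * 18 ^ (-n)`, so Borel–Cantelli excludes this.
The contour is found by a cohomological argument modulo two (`exists_surrounding_reachable`). -/

/-! ### Contours in the square lattice -/

/-- Adjacency in the square lattice. -/
def LatticeAdj (a b : ℤ × ℤ) : Prop :=
  (a.2 = b.2 ∧ (b.1 = a.1 + 1 ∨ a.1 = b.1 + 1)) ∨ (a.1 = b.1 ∧ (b.2 = a.2 + 1 ∨ a.2 = b.2 + 1))

/-- Adjacency or equality in the lattice with diagonals. -/
def KingAdj (a b : ℤ × ℤ) : Prop :=
  a.1 ≤ b.1 + 1 ∧ b.1 ≤ a.1 + 1 ∧ a.2 ≤ b.2 + 1 ∧ b.2 ≤ a.2 + 1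

/-- The square lattice restricted to the sites with `S`. -/
def siteGraph (S : ℤ × ℤ → Prop) : SimpleGraph (ℤ × ℤ) where
  Adj a b := S a ∧ S b ∧ LatticeAdj a b
  symm := ⟨fun a b h => ⟨h.2.1, h.1, by have := h.2.2; unfold LatticeAdj at *; omega⟩⟩
  loopless := ⟨fun a h => by have := h.2.2; unfold LatticeAdj at this; omega⟩

/-- The square lattice with diagonals restricted to the sites with `S`. -/
def kingGraph (S : ℤ × ℤ → Prop) : SimpleGraph (ℤ × ℤ) where
  Adj a b := a ≠ b ∧ S a ∧ S b ∧ KingAdj a b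
  symm := ⟨fun a b h => ⟨h.1.symm, h.2.2.1, h.2.1, by
    have := h.2.2.2; unfold KingAdj at *; omega⟩⟩
  loopless := ⟨fun a h => h.1 rfl⟩

/-! ### Discrete potentials and boundary crossings modulo two. -/

theorem exists_antidifference {M : Type*} [AddCommGroup M] (f : ℤ → M) :
    ∃ F : ℤ → M, F 0 = 0 ∧ ∀ x, F (x + 1) = F x + f x := by
  -- At least one interval is empty, so this is the signed sum from `0` to `x`.
  refine ⟨fun x => ∑ i ∈ Finset.Ico 0 x, f i - ∑ i ∈ Finset.Ico x 0, f i, by simp, fun x => ?_⟩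
  rcases le_or_gt 0 x with hx | hx
  · have h1 : Finset.Ico (x + 1) 0 = ∅ := Finset.Ico_eq_empty (by omega)
    have h2 : Finset.Ico x 0 = ∅ := Finset.Ico_eq_empty (by omega)
    have h3 : Finset.Ico 0 (x + 1) = insert x (Finset.Ico 0 x) := by
      ext y; simp only [Finset.mem_Ico, Finset.mem_insert]; omega
    simp only [h1, h2, h3]
    rw [Finset.sum_insert (by simp)]
    simp [add_comm]
  · have h1 : Finset.Ico 0 (x + 1) = ∅ := Finset.Ico_eq_empty (by omega)
    have h2 : Finset.Ico 0 x = ∅ := Finset.Ico_eq_empty (by omega)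
    have h3 : Finset.Ico x 0 = insert x (Finset.Ico (x + 1) 0) := by
      ext y; simp only [Finset.mem_Ico, Finset.mem_insert]; omega
    simp only [h1, h2, h3]
    rw [Finset.sum_insert (by simp)]
    simp

/-- A closed 1-cochain on the square lattice is exact. -/
theorem exists_lattice_potential {M : Type*} [AddCommGroup M] (h v : ℤ → ℤ → M)
    (hc : ∀ x y, h x y + v (x + 1) y = v x y + h x (y + 1)) :
    ∃ φ : ℤ → ℤ → M, (∀ x y, φ (x + 1) y = φ x y + h x y) ∧
      ∀ x y, φ x (y + 1) = φ x y + v x y := by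
  obtain ⟨H, -, hH⟩ := exists_antidifference fun x => h x 0
  choose V hV0 hV using fun x => exists_antidifference (v x)
  refine ⟨fun x y => H x + V x y, fun x y => ?_, fun x y => by simp only [hV, add_assoc]⟩
  -- Closedness summed over the column of plaquettes between heights `0` and `y`.
  have key : V (x + 1) y + h x 0 = V x y + h x y := by
    induction y using Int.induction_on with
    | zero => simp [hV0]
    | succ n ih =>
      rw [hV, hV, add_assoc (V x _), ← hc, ← add_assoc, ← ih]; abel
    | pred n ih =>
      have e1 := hV (x + 1) (-n - 1)
      have e2 := hV x (-n - 1)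
      have e3 := hc x (-n - 1)
      rw [sub_add_cancel] at e1 e2 e3
      rw [e1, e2] at ih
      have : V (x + 1) (-n - 1) + h x 0 + v (x + 1) (-n - 1)
          = V x (-n - 1) + h x (-n - 1) + v (x + 1) (-n - 1) := by
        rw [add_assoc (V x _), e3, ← add_assoc, ← ih]; abel
      exact add_right_cancel this
  simp only [hH]
  rw [add_assoc, add_comm (h x 0), key, add_assoc]

open Classical in
/-- The indicator, modulo two, of the edges leaving `A` whose outer end lies in `K`. -/
noncomputable def exitCochain (A K : Set (ℤ × ℤ)) (a b : ℤ × ℤ) : ZMod 2 :=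
  if (a ∈ A ∧ b ∉ A ∧ b ∈ K) ∨ (b ∈ A ∧ a ∉ A ∧ a ∈ K) then 1 else 0

theorem exitCochain_comm (A K : Set (ℤ × ℤ)) (a b : ℤ × ℤ) :
    exitCochain A K a b = exitCochain A K b a := by
  unfold exitCochain; congr 1; rw [or_comm]

-- The corners of a plaquette are pairwise `KingAdj`, so those satisfying `S` lie all in `K` or all
-- outside. On the plaquette the cochain is therefore a constant `κ` times the coboundary of the
-- indicator of `A`, hence closed.
open Classical in
theorem exitCochain_plaquette {A K : Set (ℤ × ℤ)} {S : ℤ × ℤ → Prop}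
    (hS : ∀ a ∈ A, ∀ b ∉ A, LatticeAdj a b → S b)
    (hK : ∀ a b, S a → S b → KingAdj a b → (a ∈ K ↔ b ∈ K)) (x y : ℤ) :
    exitCochain A K (x, y) (x + 1, y) + exitCochain A K (x + 1, y) (x + 1, y + 1) =
      exitCochain A K (x, y) (x, y + 1) + exitCochain A K (x, y + 1) (x + 1, y + 1) := by
  let D : Set (ℤ × ℤ) := {a | (a.1 = x ∨ a.1 = x + 1) ∧ (a.2 = y ∨ a.2 = y + 1)}
  have hD : ∀ a ∈ D, ∀ b ∈ D, S a → S b → (a ∈ K ↔ b ∈ K) := by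
    intro a ha b hb h1 h2
    refine hK a b h1 h2 ?_
    simp only [D, Set.mem_ofPred_eq] at ha hb
    simp only [KingAdj]
    omega
  obtain ⟨κ, hκ⟩ : ∃ κ : ZMod 2, ∀ a ∈ D, S a → (if a ∈ K then 1 else 0) = κ := by
    by_cases h : ∃ a ∈ D, S a ∧ a ∈ K
    · obtain ⟨a, ha, hSa, haK⟩ := h
      exact ⟨1, fun b hb hSb => if_pos ((hD a ha b hb hSa hSb).1 haK)⟩
    · exact ⟨0, fun b hb hSb => if_neg fun hbK => h ⟨b, hb, hSb, hbK⟩⟩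
  let χ : ℤ × ℤ → ZMod 2 := fun a => if a ∈ A then 1 else 0
  have key : ∀ a ∈ D, ∀ b ∈ D, LatticeAdj a b → exitCochain A K a b = κ * (χ a + χ b) := by
    intro a ha b hb hab
    have hba : LatticeAdj b a := by unfold LatticeAdj at *; omega
    by_cases h1 : a ∈ A <;> by_cases h2 : b ∈ A
    · rw [exitCochain, if_neg (by tauto)]
      simp only [χ, h1, h2, if_true]
      exact (by decide : ∀ k : ZMod 2, 0 = k * (1 + 1)) κ
    · rw [← hκ b hb (hS a h1 b h2 hab)]
      simp [exitCochain, χ, h1, h2]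
    · rw [← hκ a ha (hS b h2 a h1 hba)]
      simp [exitCochain, χ, h1, h2]
    · simp [exitCochain, χ, h1, h2]
  rw [key _ (by simp [D]) _ (by simp [D]) (by simp [LatticeAdj]),
    key _ (by simp [D]) _ (by simp [D]) (by simp [LatticeAdj]),
    key _ (by simp [D]) _ (by simp [D]) (by simp [LatticeAdj]),
    key _ (by simp [D]) _ (by simp [D]) (by simp [LatticeAdj])]
  have fin : ∀ k a b c d : ZMod 2,
    k * (a + b) + k * (b + d) = k * (a + c) + k * (c + d) := by decide
  exact fin _ _ _ _ _

/-- The potential difference counts, modulo two, the crossings of the part of the boundary of `A`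
belonging to `K`; it does not depend on the path. -/
theorem exists_exit_potential {A K : Set (ℤ × ℤ)} {S : ℤ × ℤ → Prop}
    (hS : ∀ a ∈ A, ∀ b ∉ A, LatticeAdj a b → S b)
    (hK : ∀ a b, S a → S b → KingAdj a b → (a ∈ K ↔ b ∈ K)) :
    ∃ φ : ℤ × ℤ → ZMod 2, ∀ a b, LatticeAdj a b → φ b = φ a + exitCochain A K a b := by
  obtain ⟨φ, h1, h2⟩ := exists_lattice_potential
    (fun x y => exitCochain A K (x, y) (x + 1, y)) (fun x y => exitCochain A K (x, y) (x, y + 1))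
    (exitCochain_plaquette hS hK)
  refine ⟨fun a => φ a.1 a.2, ?_⟩
  have neg : ∀ u v w : ZMod 2, u = v + w → v = u + w := by decide
  rintro ⟨a1, a2⟩ ⟨b1, b2⟩ h
  simp only [LatticeAdj] at h
  rcases h with ⟨rfl, rfl | rfl⟩ | ⟨rfl, rfl | rfl⟩
  · exact h1 _ _
  · rw [exitCochain_comm]; exact neg _ _ _ (h1 _ _)
  · exact h2 _ _
  · rw [exitCochain_comm]; exact neg _ _ _ (h2 _ _)

/-- The last exit of the horizontal ray from a finite set. -/
theorem exists_last_exit {A : Set (ℤ × ℤ)} (m : ℤ) (σ : ℤ)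
    (hm : ∀ x, m < x → (σ * x, 0) ∉ A) (n : ℕ) (hn : (σ * n, 0) ∈ A) :
    ∃ R : ℕ, n < R ∧ (σ * (R - 1 : ℤ), 0) ∈ A ∧ ∀ x : ℤ, R ≤ x → (σ * x, 0) ∉ A := by
  classical
  have hex : ∃ k : ℕ, ∀ x : ℤ, k ≤ x → (σ * x, 0) ∉ A :=
    ⟨m.toNat + 1, fun x hx => hm x (by omega)⟩
  have hlt : n < Nat.find hex := by
    by_contra hcon
    exact Nat.find_spec hex n (by omega) hn
  refine ⟨Nat.find hex, hlt, ?_, Nat.find_spec hex⟩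
  have hmin := Nat.find_min hex (m := Nat.find hex - 1) (by omega)
  push Not at hmin
  obtain ⟨x, hx, hxA⟩ := hmin
  have : ¬ (Nat.find hex : ℤ) ≤ x := fun h => Nat.find_spec hex x h hxA
  have hx' : x = (Nat.find hex : ℤ) - 1 := by omega
  rwa [← hx']

/-- A finite connected set of sites containing a horizontal segment around the origin, all of whose
outer neighbours satisfy `S`, is surrounded by a path with diagonals of sites satisfying `S`. -/
theorem exists_surrounding_reachable {A : Set (ℤ × ℤ)} {S : ℤ × ℤ → Prop} (hfin : A.Finite)
    (hconn : ∀ a ∈ A, Relation.ReflTransGen (fun a b => a ∈ A ∧ b ∈ A ∧ LatticeAdj a b) (0, 0) a)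
    (hS : ∀ a ∈ A, ∀ b ∉ A, LatticeAdj a b → S b) (n : ℕ)
    (hn : ∀ x : ℤ, -n ≤ x → x ≤ n → (x, 0) ∈ A) :
    ∃ R R' : ℕ, n < R ∧ n < R' ∧ S ((R : ℤ), 0) ∧
      (kingGraph S).Reachable ((R : ℤ), 0) (-(R' : ℤ), 0) := by
  obtain ⟨m, hm⟩ : ∃ m : ℤ, ∀ a ∈ A, a.1 < m ∧ -m < a.1 ∧ a.2 < m := by
    obtain ⟨u, hu⟩ := (hfin.image fun a : ℤ × ℤ => max |a.1| |a.2|).bddAbove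
    refine ⟨u + 1, fun a ha => ?_⟩
    have := hu ⟨a, ha, rfl⟩
    simp only [sup_le_iff, abs_le] at this
    omega
  obtain ⟨R, hnR, hRA, hR⟩ := exists_last_exit (A := A) m 1
    (fun x hx hA => by have := hm _ hA; simp at this; omega) n
    (by rw [one_mul]; exact hn _ (by omega) le_rfl)
  obtain ⟨R', hnR', hRA', hR'⟩ := exists_last_exit (A := A) m (-1)
    (fun x hx hA => by have := hm _ hA; simp at this; omega) n
    (by rw [neg_one_mul]; exact hn _ le_rfl (by omega))
  simp only [one_mul, neg_one_mul] at hRA hR hRA' hR'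
  have hSR : S ((R : ℤ), 0) := hS _ hRA _ (hR _ le_rfl) (by simp [LatticeAdj])
  -- With `K` the diagonal cluster of `(R, 0)`, leaving `A` at `(R, 0)` changes the potential. If
  -- `(-R', 0)` were not in `K`, leaving there would not, although the two exits are joined outside
  -- `A`.
  let K : Set (ℤ × ℤ) := {b | (kingGraph S).Reachable ((R : ℤ), 0) b}
  have hK : ∀ a b, S a → S b → KingAdj a b → (a ∈ K ↔ b ∈ K) := by
    intro a b ha hb hab
    rcases eq_or_ne a b with rfl | hne
    · rfl
    have hadj : (kingGraph S).Adj a b := ⟨hne, ha, hb, hab⟩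
    exact ⟨fun h => h.trans hadj.reachable, fun h => h.trans hadj.symm.reachable⟩
  obtain ⟨φ, hφ⟩ := exists_exit_potential hS hK
  have hin : ∀ a b, a ∈ A → b ∈ A → LatticeAdj a b → φ b = φ a := by
    intro a b ha hb hab
    rw [hφ a b hab, exitCochain, if_neg (by tauto), add_zero]
  have hout : ∀ a b, a ∉ A → b ∉ A → LatticeAdj a b → φ b = φ a := by
    intro a b ha hb hab
    rw [hφ a b hab, exitCochain, if_neg (by tauto), add_zero]
  have hA0 : ∀ a ∈ A, φ a = φ (0, 0) := by
    intro a ha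
    have := hconn a ha
    induction this with
    | refl => rfl
    | tail _ hab ih => rw [hin _ _ hab.1 hab.2.1 hab.2.2, ih hab.1]
  have hRK : φ ((R : ℤ), 0) = φ (0, 0) + 1 := by
    rw [hφ _ _ (show LatticeAdj ((R : ℤ) - 1, 0) ((R : ℤ), 0) by simp [LatticeAdj]), hA0 _ hRA,
      exitCochain, if_pos (Or.inl ⟨hRA, hR _ le_rfl, SimpleGraph.Reachable.refl _⟩)]
  have right : ∀ x : ℤ, R ≤ x → φ (x, 0) = φ ((R : ℤ), 0) := by
    intro x hx
    induction x, hx using Int.leInduction with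
    | base => rfl
    | succ k hk ih =>
      rw [← ih]
      exact hout _ _ (hR _ hk) (hR _ (by omega)) (by simp [LatticeAdj])
  have left : ∀ x : ℤ, R' ≤ x → φ (-x, 0) = φ (-(R' : ℤ), 0) := by
    intro x hx
    induction x, hx using Int.leInduction with
    | base => rfl
    | succ k hk ih =>
      rw [← ih]
      exact hout _ _ (hR' _ hk) (hR' _ (by omega)) (by simp [LatticeAdj])
  have vert : ∀ x : ℤ, (∀ y, (x, y) ∉ A) → ∀ y : ℤ, 0 ≤ y → φ (x, y) = φ (x, 0) := by
    intro x hx y hy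
    induction y, hy using Int.leInduction with
    | base => rfl
    | succ k hk ih =>
      rw [← ih]
      exact hout _ _ (hx _) (hx _) (by simp [LatticeAdj])
  have top : ∀ x : ℤ, -m ≤ x → φ (x, m) = φ (-m, m) := by
    intro x hx
    induction x, hx using Int.leInduction with
    | base => rfl
    | succ k hk ih =>
      rw [← ih]
      refine hout _ _ (fun h => ?_) (fun h => ?_) (by simp [LatticeAdj]) <;>
        · have := hm _ h; simp at this
  have b1 := hm _ hRA
  have b2 := hm _ hRA'
  simp only at b1 b2
  -- Detour around `A`: out along the axis, up, across the row `m` above `A`, and down again.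
  have hfar : φ (-(R' : ℤ), 0) = φ (0, 0) + 1 := by
    rw [← left m (by omega), ← vert (-m) (fun y h => by have := hm _ h; simp at this) m (by omega),
      ← top m (by omega), vert m (fun y h => by have := hm _ h; simp at this) m (by omega),
      right m (by omega), hRK]
  refine ⟨R, R', hnR, hnR', hSR, ?_⟩
  by_contra hcon
  have e := hφ _ _ (show LatticeAdj (-((R' : ℤ) - 1), 0) (-(R' : ℤ), 0) by
    simp only [LatticeAdj, true_and]; omega)
  rw [hA0 _ hRA', exitCochain, if_neg, hfar] at e
  · simp at e
  · rintro (⟨-, -, h⟩ | ⟨h, -, -⟩)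
    · exact hcon h
    · exact hR' _ le_rfl h

/-! ### The Peierls argument -/

/-- The lists of `n + 1` sites starting at `v` and making steps of the lattice with diagonals. -/
noncomputable def kingLists : ℕ → ℤ × ℤ → Finset (List (ℤ × ℤ))
  | 0, v => {[v]}
  | n + 1, v => (Finset.Icc (v.1 - 1) (v.1 + 1) ×ˢ Finset.Icc (v.2 - 1) (v.2 + 1)).biUnion
      fun u => (kingLists n u).image (v :: ·)

theorem card_kingLists_le (n : ℕ) (v : ℤ × ℤ) : (kingLists n v).card ≤ 9 ^ n := by
  induction n generalizing v with
  | zero => simp [kingLists]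
  | succ n ih =>
    refine (Finset.card_biUnion_le_card_mul _ _ (9 ^ n) fun u _ =>
      Finset.card_image_le.trans (ih u)).trans ?_
    -- A step may stay in place, hence `3 * 3 = 9` choices.
    rw [Finset.card_product, Int.card_Icc, Int.card_Icc, pow_succ']
    refine Nat.mul_le_mul_right _ ?_
    have h1 : (v.1 + 1 + 1 - (v.1 - 1)).toNat = 3 := by omega
    have h2 : (v.2 + 1 + 1 - (v.2 - 1)).toNat = 3 := by omega
    rw [h1, h2]

theorem length_of_mem_kingLists {n : ℕ} {v : ℤ × ℤ} {L : List (ℤ × ℤ)}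
    (h : L ∈ kingLists n v) : L.length = n + 1 := by
  induction n generalizing v L with
  | zero => simp [kingLists] at h; simp [h]
  | succ n ih =>
    simp only [kingLists, Finset.mem_biUnion, Finset.mem_image] at h
    obtain ⟨u, -, L', hL', rfl⟩ := h
    simp [ih hL']

theorem take_support_mem_kingLists {S : ℤ × ℤ → Prop} {u v : ℤ × ℤ} (w : (kingGraph S).Walk u v)
    (n : ℕ) (hn : n ≤ w.length) : w.support.take (n + 1) ∈ kingLists n u := by
  induction w generalizing n with
  | nil => simp at hn; simp [hn, kingLists]
  | @cons a b c hab w ih =>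
    cases n with
    | zero => simp [kingLists]
    | succ n =>
      simp only [kingLists, Finset.mem_biUnion, Finset.mem_image]
      refine ⟨b, ?_, w.support.take (n + 1), ih n (by simpa using hn), by simp⟩
      have := hab.2.2.2
      simp only [KingAdj] at this
      simp only [Finset.mem_product, Finset.mem_Icc]
      omega

/-- This forces a path from `(R, 0)` to `(-R', 0)` to have at least `R` steps. -/
theorem fst_sub_le_length {S : ℤ × ℤ → Prop} {u v : ℤ × ℤ} (w : (kingGraph S).Walk u v) :
    u.1 - v.1 ≤ w.length := by
  induction w with
  | nil => simp
  | cons hab w ih =>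
    have := hab.2.2.2.1
    simp only [SimpleGraph.Walk.length_cons]
    push_cast
    omega

theorem forall_mem_support {S : ℤ × ℤ → Prop} {u v : ℤ × ℤ} (w : (kingGraph S).Walk u v)
    (hv : S v) : ∀ a ∈ w.support, S a := by
  induction w with
  | nil => simpa using hv
  | cons hab w ih =>
    simp only [SimpleGraph.Walk.support_cons, List.mem_cons, forall_eq_or_imp]
    exact ⟨hab.2.1, ih hv⟩

/-- There are `n + 1` distinct sites satisfying `S` that make up a path with diagonals starting at
`(n, 0)`. -/
def HasKingPath (S : ℤ × ℤ → Prop) (n : ℕ) : Prop :=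
  ∃ L ∈ kingLists n ((n : ℤ), 0), L.Nodup ∧ ∀ a ∈ L, S a

theorem hasKingPath_of_reachable {S : ℤ × ℤ → Prop} {R R' : ℕ} (hS : S ((R : ℤ), 0))
    (h : (kingGraph S).Reachable ((R : ℤ), 0) (-(R' : ℤ), 0)) : HasKingPath S R := by
  -- `w` is oriented to end at `(R, 0)`, where `S` is known; its reversal supplies the list.
  obtain ⟨w, hw⟩ := h.symm.exists_isPath
  have hw' := hw.reverse
  have hlen := fst_sub_le_length w.reverse
  simp only [sub_neg_eq_add] at hlen
  refine ⟨w.reverse.support.take (R + 1), take_support_mem_kingLists _ _ (by omega),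
    hw'.support_nodup.sublist (List.take_sublist _ _), fun a ha => ?_⟩
  have ha' : a ∈ w.support := by
    have := List.mem_of_mem_take ha
    simpa using this
  exact forall_mem_support w hS a ha'

theorem mem_of_siteGraph_reachable {G : ℤ × ℤ → Prop} {a b : ℤ × ℤ} (ha : G a)
    (h : (siteGraph G).Reachable a b) : G b := by
  obtain ⟨w⟩ := h
  induction w with
  | nil => exact ha
  | cons hab w ih => exact ih hab.2.1

/-- If all the clusters of good sites are finite, then there are long paths with diagonals of bad
sites close to the origin. -/
theorem exists_hasKingPath {B : ℤ × ℤ → Prop}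
    (hB : ∀ a, ¬ B a → {b | (siteGraph fun c => ¬ B c).Reachable a b}.Finite) (n : ℕ) :
    ∃ R, n ≤ R ∧ HasKingPath B R := by
  let G : ℤ × ℤ → Prop := fun c => ¬ B c
  let J : Set (ℤ × ℤ) := (fun x : ℤ => (x, (0 : ℤ))) '' Set.Icc (-n : ℤ) n
  -- Treating the sites of `J` as open keeps the explored cluster nonempty and pushes its contour
  -- beyond distance `n`. It is finite, being contained in `J` and the clusters of the finitely many
  -- good neighbours of `J`.
  let step : ℤ × ℤ → ℤ × ℤ → Prop := fun a b => (b ∈ J ∨ G b) ∧ LatticeAdj a b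
  let A : Set (ℤ × ℤ) := {a | Relation.ReflTransGen step (0, 0) a}
  have hJ0 : ((0 : ℤ), (0 : ℤ)) ∈ J := ⟨0, by simp, rfl⟩
  have hJ : J.Finite := (Set.finite_Icc _ _).image _
  have hN : (⋃ a ∈ J, {b | LatticeAdj a b ∧ G b}).Finite := by
    refine hJ.biUnion fun a _ => Set.Finite.subset
      ((Set.finite_Icc (a.1 - 1) (a.1 + 1)).prod (Set.finite_Icc (a.2 - 1) (a.2 + 1))) ?_
    rintro b ⟨hb, -⟩
    simp only [LatticeAdj] at hb
    simp only [Set.mem_prod, Set.mem_Icc]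
    omega
  have hAfin : A.Finite := by
    refine Set.Finite.subset (hJ.union (hN.biUnion (t := fun a => {b | G a ∧
      (siteGraph G).Reachable a b}) fun a _ => ?_)) ?_
    · by_cases ha : B a
      · exact Set.Finite.subset Set.finite_empty fun b hb => hb.1 ha
      · exact (hB a ha).subset fun b hb => hb.2
    · intro a ha
      change Relation.ReflTransGen step (0, 0) a at ha
      induction ha with
      | refl => exact Or.inl hJ0
      | @tail b c _ hbc ih =>
        obtain ⟨hc | hc, hadj⟩ := hbc
        · exact Or.inl hc
        rcases ih with hb | hb
        · refine Or.inr (Set.mem_biUnion (x := c) ?_ ⟨hc, SimpleGraph.Reachable.refl _⟩)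
          exact Set.mem_biUnion hb ⟨hadj, hc⟩
        · obtain ⟨a, ha, hGa, hr⟩ := Set.mem_iUnion₂.1 hb
          refine Or.inr (Set.mem_biUnion ha ⟨hGa, hr.trans ?_⟩)
          exact SimpleGraph.Adj.reachable ⟨mem_of_siteGraph_reachable hGa hr, hc, hadj⟩
  have hAJ : J ⊆ A := by
    have right : ∀ x : ℤ, 0 ≤ x → x ≤ n → (x, 0) ∈ A := by
      intro x hx
      induction x, hx using Int.leInduction with
      | base => exact fun _ => Relation.ReflTransGen.refl
      | succ k hk ih =>
        intro hkn
        exact (ih (by omega)).tail ⟨Or.inl ⟨k + 1, by simp; omega, rfl⟩, by simp [LatticeAdj]⟩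
    have left : ∀ x : ℤ, 0 ≤ x → x ≤ n → (-x, 0) ∈ A := by
      intro x hx
      induction x, hx using Int.leInduction with
      | base => exact fun _ => Relation.ReflTransGen.refl
      | succ k hk ih =>
        intro hkn
        exact (ih (by omega)).tail ⟨Or.inl ⟨-(k + 1), by simp; omega, rfl⟩, by simp [LatticeAdj]⟩
    rintro _ ⟨x, ⟨hx1, hx2⟩, rfl⟩
    rcases le_total 0 x with h | h
    · exact right x h hx2
    · have := left (-x) (by omega) (by omega)
      rwa [neg_neg] at this
  have hconn : ∀ a ∈ A,
      Relation.ReflTransGen (fun a b => a ∈ A ∧ b ∈ A ∧ LatticeAdj a b) (0, 0) a := by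
    intro a ha
    change Relation.ReflTransGen step (0, 0) a at ha
    induction ha with
    | refl => exact Relation.ReflTransGen.refl
    | tail h1 h2 ih => exact ih.tail ⟨h1, h1.tail h2, h2.2⟩
  have hbd : ∀ a ∈ A, ∀ b ∉ A, LatticeAdj a b → B b := by
    intro a ha b hb hab
    by_contra hcon
    exact hb (Relation.ReflTransGen.tail ha ⟨Or.inr hcon, hab⟩)
  obtain ⟨R, R', hR, -, hSR, hr⟩ := exists_surrounding_reachable hAfin hconn hbd n
    fun x h1 h2 => hAJ ⟨x, ⟨h1, h2⟩, rfl⟩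
  exact ⟨R, hR.le, hasKingPath_of_reachable hSR hr⟩

/-- A random field of bad sites of the square lattice such that `k` given sites are all bad with
probability at most `18 ^ (-k)` has almost surely an infinite cluster of good sites. -/
theorem ae_exists_infinite_cluster {Ω : Type*} [MeasurableSpace Ω] (Pr : Measure Ω)
    (B : Ω → ℤ × ℤ → Prop)
    (hB : ∀ F : Finset (ℤ × ℤ), Pr {ω | ∀ a ∈ F, B ω a} ≤ (18 : ℝ≥0∞)⁻¹ ^ F.card) :
    ∀ᵐ ω ∂Pr, ∃ a, ¬ B ω a ∧ {b | (siteGraph fun c => ¬ B ω c).Reachable a b}.Infinite := by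
  have hpath : ∀ n : ℕ, Pr {ω | HasKingPath (B ω) n} ≤ (2 : ℝ≥0∞)⁻¹ ^ n := by
    intro n
    have hsub : {ω | HasKingPath (B ω) n} ⊆
        ⋃ L ∈ (kingLists n ((n : ℤ), 0)).filter List.Nodup, {ω | ∀ a ∈ L.toFinset, B ω a} := by
      rintro ω ⟨L, hL, hnd, hLB⟩
      simp only [Set.mem_iUnion]
      exact ⟨L, Finset.mem_filter.2 ⟨hL, hnd⟩, fun a ha => hLB a (List.mem_toFinset.1 ha)⟩
    refine (measure_mono hsub).trans ((measure_biUnion_finset_le _ _).trans ?_)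
    have hterm : ∀ L ∈ (kingLists n ((n : ℤ), 0)).filter List.Nodup,
        Pr {ω | ∀ a ∈ L.toFinset, B ω a} ≤ (18 : ℝ≥0∞)⁻¹ ^ n := by
      intro L hL
      rw [Finset.mem_filter] at hL
      refine (hB _).trans ?_
      rw [List.toFinset_card_of_nodup hL.2, length_of_mem_kingLists hL.1]
      exact pow_le_pow_right_of_le_one' (by simp) (Nat.le_succ n)
    refine (Finset.sum_le_card_nsmul _ _ _ hterm).trans ?_
    rw [nsmul_eq_mul]
    have hcard : (((kingLists n ((n : ℤ), 0)).filter List.Nodup).card : ℝ≥0∞) ≤ 9 ^ n := by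
      exact_mod_cast (Finset.card_filter_le _ _).trans (card_kingLists_le _ _)
    refine (mul_le_mul_left hcard _).trans ?_
    rw [← mul_pow]
    refine pow_le_pow_left' ?_ n
    rw [show (18 : ℝ≥0∞) = 9 * 2 by norm_num, ENNReal.mul_inv (by simp) (by simp), ← mul_assoc,
      ENNReal.mul_inv_cancel (by simp) (by simp), one_mul]
  -- Borel–Cantelli; it needs only bounds on outer measure, not measurability of the events.
  have hlim : Pr (Filter.limsup (fun n => {ω | HasKingPath (B ω) n}) Filter.atTop) = 0 := by
    refine measure_limsup_atTop_eq_zero (ne_top_of_le_ne_top ?_ (ENNReal.tsum_le_tsum hpath))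
    rw [ENNReal.tsum_geometric]
    simp
  refine measure_mono_null (fun ω hω => ?_) hlim
  rw [Filter.mem_limsup_iff_frequently_mem, Filter.frequently_atTop]
  intro n
  have hω' : ¬ ∃ a, ¬ B ω a ∧ {b | (siteGraph fun c => ¬ B ω c).Reachable a b}.Infinite := hω
  exact exists_hasKingPath (fun a ha => by
    by_contra hcon
    exact hω' ⟨a, ha, hcon⟩) n

/-! ### Square cells -/

/-- The index of the square cell of side `s` that contains `x`. -/
noncomputable def cellIndex (s : ℝ) (x : Plane) : ℤ × ℤ := (⌊x 0 / s⌋, ⌊x 1 / s⌋)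

/-- The half-open square cell of side `s` with index `i`. -/
noncomputable def cell (s : ℝ) (i : ℤ × ℤ) : Set Plane := cellIndex s ⁻¹' {i}

theorem measurable_cellIndex (s : ℝ) : Measurable (cellIndex s) := by
  unfold cellIndex
  fun_prop

theorem measurableSet_cell (s : ℝ) (i : ℤ × ℤ) : MeasurableSet (cell s i) :=
  measurable_cellIndex s (MeasurableSet.singleton i)

theorem pairwise_disjoint_cell (s : ℝ) : Pairwise (Function.onFun Disjoint (cell s)) :=
  fun _ _ hij => Disjoint.preimage _ (Set.disjoint_singleton.2 hij)

theorem iUnion_cell (s : ℝ) : ⋃ i, cell s i = Set.univ :=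
  Set.eq_univ_of_forall fun x => Set.mem_iUnion.2 ⟨cellIndex s x, rfl⟩

theorem mem_cell_iff {s : ℝ} (hs : 0 < s) {i : ℤ × ℤ} {x : Plane} :
    x ∈ cell s i ↔ (s * i.1 ≤ x 0 ∧ x 0 < s * i.1 + s) ∧ (s * i.2 ≤ x 1 ∧ x 1 < s * i.2 + s) := by
  simp only [cell, cellIndex, Set.mem_preimage, Set.mem_singleton_iff, Prod.ext_iff,
    Int.floor_eq_iff, le_div_iff₀ hs, div_lt_iff₀ hs, add_mul, one_mul, mul_comm s]

theorem dist_le_of_mem_cell {s : ℝ} (hs : 0 < s) {i j : ℤ × ℤ} (hij : KingAdj i j) {x y : Plane}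
    (hx : x ∈ cell s i) (hy : y ∈ cell s j) : dist x y ≤ 4 * s := by
  rw [mem_cell_iff hs] at hx hy
  obtain ⟨h1, h2, h3, h4⟩ := hij
  have c1 : (i.1 : ℝ) ≤ j.1 + 1 := by exact_mod_cast h1
  have c2 : (j.1 : ℝ) ≤ i.1 + 1 := by exact_mod_cast h2
  have c3 : (i.2 : ℝ) ≤ j.2 + 1 := by exact_mod_cast h3
  have c4 : (j.2 : ℝ) ≤ i.2 + 1 := by exact_mod_cast h4
  have d1 := mul_le_mul_of_nonneg_left c1 hs.le
  have d2 := mul_le_mul_of_nonneg_left c2 hs.le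
  have d3 := mul_le_mul_of_nonneg_left c3 hs.le
  have d4 := mul_le_mul_of_nonneg_left c4 hs.le
  rw [EuclideanSpace.dist_eq, Fin.sum_univ_two]
  refine Real.sqrt_le_iff.2 ⟨by positivity, ?_⟩
  -- Both coordinates differ by at most `2 * s`, and `2√2 ≤ 4`.
  have e0 : dist (x 0) (y 0) ≤ 2 * s := by
    rw [Real.dist_eq, abs_le]; constructor <;> linarith
  have e1 : dist (x 1) (y 1) ≤ 2 * s := by
    rw [Real.dist_eq, abs_le]; constructor <;> linarith
  have f0 := pow_le_pow_left₀ dist_nonneg e0 2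
  have f1 := pow_le_pow_left₀ dist_nonneg e1 2
  nlinarith

theorem isBounded_cell {s : ℝ} (hs : 0 < s) (i : ℤ × ℤ) : Bornology.IsBounded (cell s i) :=
  Metric.isBounded_iff.2 ⟨4 * s, fun _ hx _ hy =>
    dist_le_of_mem_cell hs (by unfold KingAdj; omega) hx hy⟩

/-- The sup norm on `ℤ²`. -/
def supNorm (k : ℤ × ℤ) : ℕ := max k.1.natAbs k.2.natAbs

/-- Each coordinate of `x - y` differs from `s` times that of `i - j` by less than `s`. -/
theorem le_dist_of_mem_cell {s : ℝ} (hs : 0 < s) {i j : ℤ × ℤ} {x y : Plane}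
    (hx : x ∈ cell s i) (hy : y ∈ cell s j) : s * supNorm (i - j) - s ≤ dist x y := by
  rw [mem_cell_iff hs] at hx hy
  have b : ∀ c : Fin 2, |x c - y c| ≤ dist x y := fun c => by
    have := PiLp.norm_apply_le (x - y) c
    rwa [← dist_eq_norm] at this
  have b0 := abs_le.1 (b 0)
  have b1 := abs_le.1 (b 1)
  rcases max_choice (i - j).1.natAbs (i - j).2.natAbs with h | h
  · have e : ((supNorm (i - j) : ℕ) : ℝ) = |(i.1 : ℝ) - j.1| := by
      rw [supNorm, h, Nat.cast_natAbs]; push_cast; simp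
    rw [e]
    rcases abs_cases ((i.1 : ℝ) - j.1) with ⟨h', -⟩ | ⟨h', -⟩ <;> rw [h'] <;> linarith
  · have e : ((supNorm (i - j) : ℕ) : ℝ) = |(i.2 : ℝ) - j.2| := by
      rw [supNorm, h, Nat.cast_natAbs]; push_cast; simp
    rw [e]
    rcases abs_cases ((i.2 : ℝ) - j.2) with ⟨h', -⟩ | ⟨h', -⟩ <;> rw [h'] <;> linarith

theorem volume_cell {s : ℝ} (hs : 0 < s) (i : ℤ × ℤ) :
    volume (cell s i) = ENNReal.ofReal (s ^ 2) := by
  have h : cell s i = (WithLp.ofLp : Plane → Fin 2 → ℝ) ⁻¹'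
      (Set.univ.pi fun c => Set.Ico (![s * i.1, s * i.2] c) (![s * i.1, s * i.2] c + s)) := by
    ext x
    rw [mem_cell_iff hs]
    simp [Fin.forall_fin_two]
  rw [h, (PiLp.volume_preserving_ofLp (Fin 2)).measure_preimage
    (MeasurableSet.univ_pi fun _ => measurableSet_Ico).nullMeasurableSet, volume_pi_pi]
  simp [Real.volume_Ico, pow_two, ENNReal.ofReal_mul hs.le]

theorem volume_biUnion_cell {s : ℝ} (hs : 0 < s) (F : Finset (ℤ × ℤ)) :
    volume (⋃ i ∈ F, cell s i) = ENNReal.ofReal (F.card * s ^ 2) := by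
  rw [measure_biUnion_finset (fun i _ j _ hij => pairwise_disjoint_cell s hij)
    fun i _ => measurableSet_cell s i]
  simp only [volume_cell hs, Finset.sum_const, nsmul_eq_mul]
  rw [ENNReal.ofReal_mul (by positivity), ENNReal.ofReal_natCast]

/-- A locally finite counting measure has an atom in each set of positive measure. -/
theorem exists_atom {ν : Measure Plane}
    (hν : ∀ B : Set Plane, MeasurableSet B → Bornology.IsBounded B → ∃ k : ℕ, ν B = k)
    {Q : Set Plane} (hQ : MeasurableSet Q) (hQb : Bornology.IsBounded Q) (h0 : ν Q ≠ 0) :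
    ∃ x ∈ Q, ν {x} ≠ 0 := by
  -- All relative neighbourhoods of `x` in `Q` have positive, hence by integrality at least unit,
  -- mass. Continuity from above passes this to `{x}`.
  obtain ⟨x, hxQ, hx⟩ := exists_mem_forall_mem_nhdsWithin_pos_measure h0
  refine ⟨x, hxQ, ?_⟩
  let t : ℕ → Set Plane := fun n => Q ∩ Metric.closedBall x (1 / ((n : ℝ) + 1))
  have ht : ∀ n, MeasurableSet (t n) := fun n => hQ.inter measurableSet_closedBall
  have htb : ∀ n, Bornology.IsBounded (t n) := fun n => hQb.subset Set.inter_subset_left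
  have hanti : Antitone t := fun m n hmn => Set.inter_subset_inter_right _
    (Metric.closedBall_subset_closedBall (one_div_le_one_div_of_le (by positivity)
      (by exact_mod_cast Nat.succ_le_succ hmn)))
  have hfin : ∃ n, ν (t n) ≠ ∞ := ⟨0, by
    obtain ⟨k, hk⟩ := hν _ (ht 0) (htb 0)
    simp [hk]⟩
  have hone : ∀ n, 1 ≤ ν (t n) := by
    intro n
    obtain ⟨k, hk⟩ := hν _ (ht n) (htb n)
    have hpos := hx (t n) (Filter.inter_mem self_mem_nhdsWithin
      (mem_nhdsWithin_of_mem_nhds (Metric.closedBall_mem_nhds x (by positivity))))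
    rw [hk] at hpos ⊢
    have : 0 < k := by exact_mod_cast hpos
    exact_mod_cast this
  have hlim := tendsto_measure_iInter_atTop (μ := ν) (fun n => (ht n).nullMeasurableSet) hanti hfin
  have hsub : ⋂ n, t n ⊆ {x} := by
    intro y hy
    rw [Set.mem_iInter] at hy
    have hd : ∀ n : ℕ, dist y x ≤ 1 / ((n : ℝ) + 1) := fun n => (hy n).2
    have := ge_of_tendsto' tendsto_one_div_add_atTop_nhds_zero_nat hd
    exact dist_le_zero.1 this
  have h1 : 1 ≤ ν (⋂ n, t n) := ge_of_tendsto' hlim hone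
  have h2 := h1.trans (measure_mono hsub)
  intro h
  rw [h] at h2
  simp at h2

/-! ### Attenuation along the cells -/

theorem IsAttenuation.antitoneOn {l : ℝ → ℝ} (hl : IsAttenuation l) (hpos : ∀ r, 0 ≤ r → 0 < l r) :
    AntitoneOn l (Set.Ici 0) :=
  fun a ha b hb hab => hl.strictAntiOn.antitoneOn ⟨ha, (hpos a ha).ne'⟩ ⟨hb, (hpos b hb).ne'⟩ hab

/-- A bound for the attenuation between points of cells whose indices differ by `k`. -/
noncomputable def cellWeight (l : ℝ → ℝ) (s : ℝ) (k : ℤ × ℤ) : ℝ := l (max 0 (s * supNorm k - s))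

theorem cellWeight_nonneg {l : ℝ → ℝ} (hl : IsAttenuation l) (s : ℝ) (k : ℤ × ℤ) :
    0 ≤ cellWeight l s k := hl.nonneg _ (le_max_left _ _)

theorem le_cellWeight {l : ℝ → ℝ} (hl : AntitoneOn l (Set.Ici 0)) {s : ℝ} (hs : 0 < s)
    {i j : ℤ × ℤ} {x y : Plane} (hx : x ∈ cell s i) (hy : y ∈ cell s j) :
    l (dist x y) ≤ cellWeight l s (i - j) :=
  hl (Set.mem_Ici.2 (le_max_left _ _)) dist_nonneg (max_le dist_nonneg (le_dist_of_mem_cell hs hx hy))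

/-- A sup-norm sphere of radius `n > 0` has `8 * n` points; the extra `1` covers `n = 0`. -/
theorem tsum_comp_supNorm_le (g : ℕ → ℝ≥0∞) :
    ∑' k : ℤ × ℤ, g (supNorm k) ≤ ∑' n : ℕ, (8 * n + 1) * g n := by
  rw [← (Equiv.sigmaFiberEquiv supNorm).tsum_eq, ENNReal.tsum_sigma']
  refine ENNReal.tsum_le_tsum fun n => ?_
  have h : ∀ b : {k : ℤ × ℤ // supNorm k = n},
      g (supNorm (Equiv.sigmaFiberEquiv supNorm ⟨n, b⟩)) = g n := fun b =>
    congrArg g b.2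
  simp only [h, ENNReal.tsum_const]
  refine mul_le_mul_left ?_ _
  have hc : ENat.card {k : ℤ × ℤ // supNorm k = n} = (Finset.box n : Finset (ℤ × ℤ)).card := by
    rw [← Set.encard_coe_eq_coe_finsetCard]
    change Set.encard {k : ℤ × ℤ | supNorm k = n} = _
    congr 1
    ext k
    simp [supNorm]
  rw [hc]
  rcases eq_or_ne n 0 with rfl | hn
  · simp
  · rw [Int.card_box hn]
    simp

/-- Integral test: the sphere of radius `n` contributes of order `n * l (s * (n - 1))`, comparable
with a piece of the convergent integral of `r * l r`. -/
theorem tsum_cellWeight_lt_top {l : ℝ → ℝ} (hl : IsAttenuation l) (hanti : AntitoneOn l (Set.Ici 0))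
    {s : ℝ} (hs : 0 < s) : ∑' k, ENNReal.ofReal (cellWeight l s k) < ∞ := by
  let g : ℕ → ℝ≥0∞ := fun n => ENNReal.ofReal (l (max 0 (s * n - s)))
  refine (tsum_comp_supNorm_le g).trans_lt ?_
  -- After three shells, the comparison interval `(s(n+1), s(n+2)]` lies in the positive half-line.
  rw [← ENNReal.summable.sum_add_tsum_nat_add' (k := 3)]
  refine ENNReal.add_lt_top.2 ⟨ENNReal.sum_lt_top.2 fun n _ =>
    ENNReal.mul_lt_top (by finiteness) ENNReal.ofReal_lt_top, ?_⟩
  let t : ℕ → ℝ := fun n => s * (n + 1)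
  have ht : Monotone t := fun m n hmn => by
    have : (m : ℝ) ≤ n := by exact_mod_cast hmn
    exact mul_le_mul_of_nonneg_left (by linarith) hs.le
  -- The `25` comes from `8(n+3) + 1 ≤ 25(n+1)`.
  have hterm : ∀ n : ℕ, (8 * ((n + 3 : ℕ) : ℝ≥0∞) + 1) * g (n + 3) ≤
      ENNReal.ofReal (25 / s ^ 2) *
        ∫⁻ r in Set.Ioc (t n) (t (Order.succ n)), ENNReal.ofReal (r * l r) := by
    intro n
    have hn : (0 : ℝ) ≤ n := n.cast_nonneg
    have harg : max 0 (s * ((n + 3 : ℕ) : ℝ) - s) = s * (n + 2) := by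
      push_cast
      rw [max_eq_right (by nlinarith)]; ring
    have hsucc : t (Order.succ n) = s * (n + 2) := by
      simp only [t, Order.succ_eq_add_one]; push_cast; ring
    rw [hsucc]
    have hlow : ∀ r ∈ Set.Ioc (t n) (s * (n + 2)),
        ENNReal.ofReal (s * (n + 1) * l (s * (n + 2))) ≤ ENNReal.ofReal (r * l r) := by
      intro r hr
      have hr0 : 0 ≤ r := le_trans (by positivity) hr.1.le
      refine ENNReal.ofReal_le_ofReal (mul_le_mul hr.1.le
        (hanti hr0 (Set.mem_Ici.2 (by positivity)) hr.2) (hl.nonneg _ (by positivity)) hr0)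
    have hint := setLIntegral_mono' (μ := volume) measurableSet_Ioc hlow
    rw [setLIntegral_const, Real.volume_Ioc] at hint
    have hlen : s * (n + 2) - t n = s := by simp only [t]; ring
    rw [hlen] at hint
    refine le_trans ?_ (mul_le_mul_right hint _)
    have e1 : (8 * ((n + 3 : ℕ) : ℝ≥0∞) + 1) = ENNReal.ofReal (8 * (n + 3) + 1) := by
      have := (ENNReal.ofReal_natCast (8 * (n + 3) + 1)).symm
      push_cast at this ⊢
      exact this
    simp only [g, harg]
    have hll := hl.nonneg (s * (n + 2)) (by positivity)
    rw [e1, ← ENNReal.ofReal_mul (by positivity), ← ENNReal.ofReal_mul (by positivity),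
      ← ENNReal.ofReal_mul (by positivity)]
    refine ENNReal.ofReal_le_ofReal ?_
    have : 25 / s ^ 2 * (s * (n + 1) * l (s * (n + 2)) * s) =
        25 * (n + 1) * l (s * (n + 2)) := by field_simp
    rw [this]
    exact mul_le_mul_of_nonneg_right (by linarith) hll
  refine (ENNReal.tsum_le_tsum hterm).trans_lt ?_
  rw [ENNReal.tsum_mul_left, ← lintegral_iUnion (fun _ => measurableSet_Ioc)
    ht.pairwise_disjoint_on_Ioc_succ]
  refine ENNReal.mul_lt_top ENNReal.ofReal_lt_top ?_
  refine (lintegral_mono_set (t := Set.Ioi 0) ?_).trans_lt ?_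
  · refine Set.iUnion_subset fun n r hr => lt_of_le_of_lt ?_ hr.1
    simp only [t]; positivity
  · refine lt_of_le_of_lt (lintegral_mono fun r => ?_) hl.integrableOn.2
    exact Real.ofReal_le_enorm _

/-- The interference at any point of the cell `i` is at most this weighted sum over the cells. -/
noncomputable def cellInterference (l : ℝ → ℝ) (s : ℝ) (ν : Measure Plane) (i : ℤ × ℤ) : ℝ≥0∞ :=
  ∑' j, ENNReal.ofReal (cellWeight l s (i - j)) * ν (cell s j)

theorem interference_le_cellInterference {l : ℝ → ℝ} (hl : AntitoneOn l (Set.Ici 0)) {s : ℝ}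
    (hs : 0 < s) (ν : Measure Plane) (x : Plane) {y : Plane} {i : ℤ × ℤ} (hy : y ∈ cell s i) :
    interference l (ν.restrict {x}ᶜ) y ≤ cellInterference l s ν i := by
  refine (lintegral_mono' (Measure.restrict_le_self.trans Measure.restrict_le_self) le_rfl).trans ?_
  rw [← setLIntegral_univ, ← iUnion_cell s,
    lintegral_iUnion (measurableSet_cell s) (pairwise_disjoint_cell s)]
  refine ENNReal.tsum_le_tsum fun j => ?_
  rw [← setLIntegral_const]
  refine setLIntegral_mono' (measurableSet_cell s j) fun z hz => ENNReal.ofReal_le_ofReal ?_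
  rw [dist_comm]
  exact le_cellWeight hl hs hy hz

/-! ### Consequences of the orders -/

/-- Convexity of the positive part; `p ≤ x, y` follows from the equal sums. -/
theorem max_zero_add_max_zero_le {p x y q : ℝ} (hxq : x ≤ q) (hyq : y ≤ q)
    (h : x + y = p + q) : max 0 x + max 0 y ≤ max 0 p + max 0 q := by
  rcases max_choice 0 x with hx | hx <;> rcases max_choice 0 y with hy | hy <;> rw [hx, hy] <;>
    linarith [le_max_left 0 p, le_max_right 0 p, le_max_left 0 q, le_max_right 0 q]

/-- Linear growth makes this test function integrable under finite mean measure alone, which an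
exponential would not be. -/
theorem isIdcx_max_zero_affine {n : ℕ} (c : Fin n → ℝ) (hc : ∀ i, 0 ≤ c i) (d : ℝ) :
    IsIdcx fun x : Fin n → ℝ => max 0 (∑ i, c i * x i + d) := by
  have hmono : ∀ x y : Fin n → ℝ, x ≤ y → ∑ i, c i * x i + d ≤ ∑ i, c i * y i + d :=
    fun x y hxy => add_le_add_left
      (Finset.sum_le_sum fun i _ => mul_le_mul_of_nonneg_left (hxy i) (hc i)) d
  refine ⟨fun x y p q _ h2 _ h4 h => ?_, fun x y hxy => max_le_max le_rfl (hmono x y hxy)⟩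
  refine max_zero_add_max_zero_le (hmono _ _ h2) (hmono _ _ h4) ?_
  have hsum : ∑ i, c i * x i + ∑ i, c i * y i = ∑ i, c i * p i + ∑ i, c i * q i := by
    rw [← Finset.sum_add_distrib, ← Finset.sum_add_distrib]
    refine Finset.sum_congr rfl fun i _ => ?_
    have := congrFun h i
    simp only [Pi.add_apply] at this
    rw [← mul_add, this, mul_add]
  linarith

/-- On natural numbers this function is the indicator of `0`, so it turns the ddcx order into a
comparison of void probabilities. -/
theorem isDdcx_max_zero_one_sub : IsDdcx fun x : Fin 1 → ℝ => max 0 (1 - x 0) := by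
  refine ⟨fun x y p q h1 _ h3 _ h => ?_,
    fun x y hxy => max_le_max le_rfl (sub_le_sub_left (hxy 0) 1)⟩
  have h0 := congrFun h 0
  simp only [Pi.add_apply] at h0
  have := max_zero_add_max_zero_le (p := 1 - q 0) (x := 1 - x 0) (y := 1 - y 0) (q := 1 - p 0)
    (by linarith [h1 0]) (by linarith [h3 0]) (by linarith)
  linarith

/-! ### Void probabilities and large deviations from the orders. -/

section PointProcess

variable {Ω : Type*} [MeasurableSpace Ω]

theorem IsPointProcess.measurable_apply {Φ : Ω → Measure Plane} (hΦ : IsPointProcess Φ)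
    {D : Set Plane} (hD : MeasurableSet D) : Measurable fun ω => Φ ω D :=
  (Measure.measurable_coe hD).comp hΦ.measurable

theorem IsPointProcess.measurableSet_void {Φ : Ω → Measure Plane} (hΦ : IsPointProcess Φ)
    {D : Set Plane} (hD : MeasurableSet D) : MeasurableSet {ω | Φ ω D = 0} :=
  hΦ.measurable_apply hD (MeasurableSet.singleton 0)

theorem IsPointProcess.max_zero_one_sub {Φ : Ω → Measure Plane} (hΦ : IsPointProcess Φ)
    {D : Set Plane} (hD : MeasurableSet D) (hDb : Bornology.IsBounded D) :
    (fun ω => max 0 (1 - (Φ ω D).toReal)) = {ω | Φ ω D = 0}.indicator fun _ => (1 : ℝ) := by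
  funext ω
  obtain ⟨k, hk⟩ := hΦ.count_nat ω D hD hDb
  rcases Nat.eq_zero_or_pos k with rfl | hpos
  · have h : ω ∈ {ω | Φ ω D = 0} := by simpa using hk
    rw [Set.indicator_of_mem h, hk]
    simp
  · have h : ω ∉ {ω | Φ ω D = 0} := by
      simp only [Set.mem_ofPred_eq, hk]
      exact_mod_cast hpos.ne'
    rw [Set.indicator_of_notMem h, hk]
    have : (1 : ℝ) ≤ k := by exact_mod_cast hpos
    simpa using this

variable {Ω' : Type*} [MeasurableSpace Ω']

theorem IsPoissonProcess.measure_void {Pr : Measure Ω} {Φ : Ω → Measure Plane} {lam : ℝ≥0}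
    (hΦ : IsPoissonProcess Pr Φ lam) {D : Set Plane} (hD : MeasurableSet D)
    (hDb : Bornology.IsBounded D) :
    Pr {ω | Φ ω D = 0} = ENNReal.ofReal (Real.exp (-(lam * (volume D).toReal))) := by
  have h := congrArg (fun ν : Measure ℝ≥0∞ => ν {0}) (hΦ.law_count D hD hDb)
  rw [Measure.map_apply (hΦ.measurable_apply hD) (MeasurableSet.singleton 0),
    Measure.map_apply measurable_from_top (MeasurableSet.singleton 0)] at h
  have hpre : (fun k : ℕ => (k : ℝ≥0∞)) ⁻¹' {0} = {0} := by ext k; simp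
  rw [hpre, poissonMeasure_singleton] at h
  refine h.trans ?_
  simp only [NNReal.coe_mul, pow_zero, mul_one, Nat.factorial_zero, Nat.cast_one, div_one]
  rfl

/-- The void probabilities of a process that is `ddcx`-smaller than a Poisson process. -/
theorem measure_void_le {Pr : Measure Ω} [IsProbabilityMeasure Pr] {Pr' : Measure Ω'}
    [IsProbabilityMeasure Pr'] {Φ : Ω → Measure Plane} {Φ' : Ω' → Measure Plane} {lam : ℝ≥0}
    (hΦ : IsPointProcess Φ) (hΦ' : IsPoissonProcess Pr' Φ' lam) (hle : PPLeDdcx Pr Φ Pr' Φ')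
    {D : Set Plane} (hD : MeasurableSet D) (hDb : Bornology.IsBounded D) :
    Pr {ω | Φ ω D = 0} ≤ ENNReal.ofReal (Real.exp (-(lam * (volume D).toReal))) := by
  rw [← hΦ'.measure_void hD hDb]
  have h1 := hΦ.max_zero_one_sub hD hDb
  have h2 := hΦ'.toIsPointProcess.max_zero_one_sub hD hDb
  have h := hle 1 (fun _ => D) (fun _ => hD) (fun _ => hDb) _ isDdcx_max_zero_one_sub
  simp only [countVec] at h
  rw [h1, h2, integral_indicator_const _ (hΦ.measurableSet_void hD),
    integral_indicator_const _ (hΦ'.toIsPointProcess.measurableSet_void hD)] at h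
  have h' := h ((integrable_const _).indicator (hΦ.measurableSet_void hD))
    ((integrable_const _).indicator (hΦ'.toIsPointProcess.measurableSet_void hD))
  simp only [smul_eq_mul, mul_one] at h'
  exact (ENNReal.toReal_le_toReal (measure_ne_top _ _) (measure_ne_top _ _)).1 h'

theorem hasSum_exp_poisson (r : ℝ≥0) (c : ℝ) :
    HasSum (fun n : ℕ => Real.exp (-r) * r ^ n / n.factorial * Real.exp (c * n))
      (Real.exp (r * (Real.exp c - 1))) := by
  have h := (NormedSpace.expSeries_div_hasSum_exp ((r : ℝ) * Real.exp c)).mul_left (Real.exp (-r))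
  rw [← Real.exp_eq_exp_ℝ, ← Real.exp_add] at h
  convert! h using 1
  · funext n
    rw [mul_pow, ← Real.exp_nat_mul, mul_comm c]
    ring
  · congr 1; ring

theorem integrable_exp_poisson (r : ℝ≥0) (c : ℝ) :
    Integrable (fun n : ℕ => Real.exp (c * n)) (poissonMeasure r) := by
  rw [integrable_poissonMeasure_iff]
  simpa only [Real.norm_eq_abs, Real.abs_exp] using (hasSum_exp_poisson r c).summable

theorem integral_exp_poisson (r : ℝ≥0) (c : ℝ) :
    ∫ n : ℕ, Real.exp (c * n) ∂poissonMeasure r = Real.exp (r * (Real.exp c - 1)) :=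
  (hasSum_integral_poissonMeasure (integrable_exp_poisson r c)).unique (hasSum_exp_poisson r c)

theorem measurable_exp_mul_toReal (c : ℝ) : Measurable fun x : ℝ≥0∞ => Real.exp (c * x.toReal) := by
  fun_prop

theorem IsPoissonProcess.integrable_exp {Pr : Measure Ω} {Φ : Ω → Measure Plane} {lam : ℝ≥0}
    (hΦ : IsPoissonProcess Pr Φ lam) {D : Set Plane} (hD : MeasurableSet D)
    (hDb : Bornology.IsBounded D) (c : ℝ) :
    Integrable (fun ω => Real.exp (c * (Φ ω D).toReal)) Pr := by
  have h := integrable_exp_poisson (lam * (volume D).toNNReal) c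
  have h2 : Integrable (fun x : ℝ≥0∞ => Real.exp (c * x.toReal)) (Pr.map fun ω => Φ ω D) := by
    rw [hΦ.law_count D hD hDb, integrable_map_measure
      (measurable_exp_mul_toReal c).aestronglyMeasurable measurable_from_top.aemeasurable]
    simpa [Function.comp_def] using h
  exact (integrable_map_measure (measurable_exp_mul_toReal c).aestronglyMeasurable
    (hΦ.toIsPointProcess.measurable_apply hD).aemeasurable).1 h2

theorem IsPoissonProcess.integral_exp {Pr : Measure Ω} {Φ : Ω → Measure Plane} {lam : ℝ≥0}
    (hΦ : IsPoissonProcess Pr Φ lam) {D : Set Plane} (hD : MeasurableSet D)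
    (hDb : Bornology.IsBounded D) (c : ℝ) :
    ∫ ω, Real.exp (c * (Φ ω D).toReal) ∂Pr =
      Real.exp (lam * (volume D).toReal * (Real.exp c - 1)) := by
  have h := integral_exp_poisson (lam * (volume D).toNNReal) c
  have h2 : ∫ x : ℝ≥0∞, Real.exp (c * x.toReal) ∂(Pr.map fun ω => Φ ω D) =
      Real.exp (lam * (volume D).toReal * (Real.exp c - 1)) := by
    rw [hΦ.law_count D hD hDb, integral_map measurable_from_top.aemeasurable
      (measurable_exp_mul_toReal c).aestronglyMeasurable]
    simp only [ENNReal.toReal_natCast]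
    rw [NNReal.coe_mul] at h
    exact h
  rwa [integral_map (hΦ.toIsPointProcess.measurable_apply hD).aemeasurable
    (measurable_exp_mul_toReal c).aestronglyMeasurable] at h2

/-- The exponential moments of a weighted number of points of a Poisson process. -/
theorem IsPoissonProcess.integral_exp_sum_le {Pr : Measure Ω} [IsProbabilityMeasure Pr]
    {Φ : Ω → Measure Plane} {lam : ℝ≥0}
    (hΦ : IsPoissonProcess Pr Φ lam) {n : ℕ} (D : Fin n → Set Plane)
    (hD : ∀ i, MeasurableSet (D i)) (hDb : ∀ i, Bornology.IsBounded (D i))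
    (hdisj : Pairwise fun i j => Disjoint (D i) (D j)) (c : Fin n → ℝ) (hc0 : ∀ i, 0 ≤ c i)
    (hc1 : ∀ i, c i ≤ 1) :
    Integrable (fun ω => Real.exp (∑ i, c i * (Φ ω (D i)).toReal)) Pr ∧
      ∫ ω, Real.exp (∑ i, c i * (Φ ω (D i)).toReal) ∂Pr ≤
        Real.exp (2 * lam * ∑ i, c i * (volume (D i)).toReal) := by
  let Y : Fin n → Ω → ℝ := fun i ω => c i * (Φ ω (D i)).toReal
  have hYm : ∀ i, Measurable (Y i) := fun i =>
    (hΦ.toIsPointProcess.measurable_apply (hD i)).ennreal_toReal.const_mul (c i)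
  have hind : iIndepFun Y Pr :=
    (hΦ.indep_count n D hD hDb hdisj).comp (fun i x => c i * x.toReal) fun i => by fun_prop
  have hmgf : ∀ i, mgf (Y i) Pr 1 = Real.exp (lam * (volume (D i)).toReal * (Real.exp (c i) - 1)) :=
    fun i => by simp only [mgf, one_mul, Y]; exact hΦ.integral_exp (hD i) (hDb i) (c i)
  have hint := hind.integrable_exp_mul_sum hYm (t := 1) (s := Finset.univ) fun i _ => by
    simp only [one_mul, Y]; exact hΦ.integrable_exp (hD i) (hDb i) (c i)
  have hval := hind.mgf_sum hYm Finset.univ (t := 1)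
  simp only [mgf, one_mul, Finset.sum_apply, Y] at hint hval
  refine ⟨hint, ?_⟩
  rw [hval]
  have hterm : ∀ i ∈ Finset.univ, ∫ ω, Real.exp (c i * (Φ ω (D i)).toReal) ∂Pr ≤
      Real.exp (2 * lam * (c i * (volume (D i)).toReal)) := by
    intro i _
    rw [hΦ.integral_exp (hD i) (hDb i) (c i), Real.exp_le_exp]
    -- The factor `2` is from `exp c - 1 ≤ 2 * c` on `[0, 1]`.
    have habs := Real.abs_exp_sub_one_le (x := c i) (by rw [abs_of_nonneg (hc0 i)]; exact hc1 i)
    rw [abs_of_nonneg (hc0 i)] at habs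
    have h2 := (le_abs_self _).trans habs
    have h3 : (0 : ℝ) ≤ lam * (volume (D i)).toReal := by positivity
    nlinarith [mul_le_mul_of_nonneg_left h2 h3]
  refine (Finset.prod_le_prod (fun i _ => integral_nonneg fun ω => (Real.exp_pos _).le)
    hterm).trans ?_
  rw [← Real.exp_sum, Finset.mul_sum]

/-- Large deviations of the weighted number of points of a process that is `idcx`-smaller than a
Poisson process. -/
theorem measure_lt_sum_le {Pr : Measure Ω} [IsProbabilityMeasure Pr] {Pr' : Measure Ω'}
    [IsProbabilityMeasure Pr'] {Φ : Ω → Measure Plane} {Φ' : Ω' → Measure Plane} {lam : ℝ≥0}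
    (hΦ : IsPointProcess Φ) (hΦ' : IsPoissonProcess Pr' Φ' lam) (hle : PPLeIdcx Pr Φ Pr' Φ')
    (hmean : ∀ B : Set Plane, MeasurableSet B → Bornology.IsBounded B → ∫⁻ ω, Φ ω B ∂Pr < ∞)
    {n : ℕ} (D : Fin n → Set Plane)
    (hD : ∀ i, MeasurableSet (D i)) (hDb : ∀ i, Bornology.IsBounded (D i))
    (hdisj : Pairwise fun i j => Disjoint (D i) (D j)) (c : Fin n → ℝ) (hc0 : ∀ i, 0 ≤ c i)
    (hc1 : ∀ i, c i ≤ 1) (d : ℝ) :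
    Pr {ω | d < ∑ i, c i * (Φ ω (D i)).toReal} ≤
      ENNReal.ofReal (Real.exp (1 - d + 2 * lam * ∑ i, c i * (volume (D i)).toReal)) := by
  obtain ⟨hexp, hexp_le⟩ := hΦ'.integral_exp_sum_le D hD hDb hdisj c hc0 hc1
  have hi1 : Integrable (fun ω => max 0 (∑ i, c i * (Φ ω (D i)).toReal + (1 - d))) Pr := by
    refine (integrable_zero _ _ _).sup (Integrable.add ?_ (integrable_const _))
    exact integrable_finsetSum _ fun i _ => (integrable_toReal_of_lintegral_ne_top
      (hΦ.measurable_apply (hD i)).aemeasurable (hmean _ (hD i) (hDb i)).ne).const_mul _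
  -- The bound `max 0 u ≤ exp u` brings in exponential moments only on the Poisson side. The shift
  -- `1 - d` lets Markov's inequality be used at level `1`.
  have hbd : ∀ ω, max 0 (∑ i, c i * (Φ' ω (D i)).toReal + (1 - d)) ≤
      Real.exp (∑ i, c i * (Φ' ω (D i)).toReal) * Real.exp (1 - d) := fun ω => by
    rw [← Real.exp_add]
    exact max_le (Real.exp_pos _).le ((le_add_of_nonneg_right zero_le_one).trans
      (Real.add_one_le_exp _))
  have hm2 : Measurable fun ω => ∑ i, c i * (Φ' ω (D i)).toReal :=
    Finset.measurable_sum _ fun i _ =>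
      (hΦ'.toIsPointProcess.measurable_apply (hD i)).ennreal_toReal.const_mul (c i)
  have hi2 : Integrable (fun ω => max 0 (∑ i, c i * (Φ' ω (D i)).toReal + (1 - d))) Pr' := by
    refine (hexp.mul_const (Real.exp (1 - d))).mono'
      (measurable_const.max (hm2.add_const _)).aestronglyMeasurable
      (Filter.Eventually.of_forall fun ω => ?_)
    rw [Real.norm_of_nonneg (le_max_left _ _)]
    exact hbd ω
  have hcomp := hle n D hD hDb _ (isIdcx_max_zero_affine c hc0 (1 - d)) hi1 hi2
  simp only [countVec] at hcomp
  have hupper : ∫ ω, max 0 (∑ i, c i * (Φ' ω (D i)).toReal + (1 - d)) ∂Pr' ≤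
      Real.exp (1 - d + 2 * lam * ∑ i, c i * (volume (D i)).toReal) := by
    refine (integral_mono hi2 (hexp.mul_const _) hbd).trans ?_
    rw [integral_mul_const, add_comm, Real.exp_add]
    exact mul_le_mul_of_nonneg_right hexp_le (Real.exp_pos _).le
  have hmarkov := mul_meas_ge_le_integral_of_nonneg
    (Filter.Eventually.of_forall fun ω => le_max_left 0 (∑ i, c i * (Φ ω (D i)).toReal + (1 - d)))
    hi1 1
  rw [one_mul] at hmarkov
  have hsub : {ω | d < ∑ i, c i * (Φ ω (D i)).toReal} ⊆
      {ω | 1 ≤ max 0 (∑ i, c i * (Φ ω (D i)).toReal + (1 - d))} := fun ω hω => by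
    have : d < ∑ i, c i * (Φ ω (D i)).toReal := hω
    change (1 : ℝ) ≤ max 0 (∑ i, c i * (Φ ω (D i)).toReal + (1 - d))
    exact le_max_of_le_right (by linarith)
  refine (measure_mono hsub).trans ?_
  rw [← ofReal_measureReal]
  exact ENNReal.ofReal_le_ofReal (hmarkov.trans (hcomp.trans hupper))

theorem summable_cellWeight {l : ℝ → ℝ} (hl : IsAttenuation l) (hanti : AntitoneOn l (Set.Ici 0))
    {s : ℝ} (hs : 0 < s) : Summable (cellWeight l s) := by
  have h := ENNReal.summable_toReal (tsum_cellWeight_lt_top hl hanti hs).ne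
  simpa only [ENNReal.toReal_ofReal (cellWeight_nonneg hl s _)] using h

/-- The probability of large interference in all of finitely many given cells. -/
theorem measure_forall_lt_cellInterference_le {Pr : Measure Ω} [IsProbabilityMeasure Pr]
    {Pr' : Measure Ω'} [IsProbabilityMeasure Pr'] {Φ : Ω → Measure Plane}
    {Φ' : Ω' → Measure Plane} {mu : ℝ≥0} (hΦ : IsPointProcess Φ)
    (hΦ' : IsPoissonProcess Pr' Φ' mu) (hle : PPLeIdcx Pr Φ Pr' Φ')
    (hmean : ∀ B : Set Plane, MeasurableSet B → Bornology.IsBounded B → ∫⁻ ω, Φ ω B ∂Pr < ∞)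
    {l : ℝ → ℝ} (hl : IsAttenuation l) (hpos : ∀ r, 0 ≤ r → 0 < l r) {s : ℝ} (hs : 0 < s)
    {M : ℝ} (hM : 0 ≤ M) {F : Finset (ℤ × ℤ)} (hF : F.Nonempty) :
    Pr {ω | ∀ i ∈ F, ENNReal.ofReal ((∑' k, cellWeight l s k) * M) <
      cellInterference l s (Φ ω) i} ≤
      ENNReal.ofReal (Real.exp (1 + F.card * (2 * mu * s ^ 2 - M))) := by
  have hanti := hl.antitoneOn hpos
  have hsum := summable_cellWeight hl hanti hs
  have hw0 := cellWeight_nonneg hl s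
  set W := ∑' k, cellWeight l s k with hW
  have hWpos : 0 < W := hsum.tsum_pos hw0 0 (hpos _ (le_max_left _ _))
  have hrow : ∀ j, ∑ i ∈ F, cellWeight l s (i - j) ≤ W := fun j => by
    have h := (Equiv.subRight j).tsum_eq (cellWeight l s)
    rw [hW, ← h]
    exact ((Equiv.subRight j).summable_iff.2 hsum).sum_le_tsum F fun i _ => hw0 _
  have hcol : ∀ (J : Finset (ℤ × ℤ)) i, ∑ j ∈ J, cellWeight l s (i - j) ≤ W := fun J i => by
    have h := (Equiv.subLeft i).tsum_eq (cellWeight l s)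
    rw [hW, ← h]
    exact ((Equiv.subLeft i).summable_iff.2 hsum).sum_le_tsum J fun i _ => hw0 _
  -- Normalized total weight of cell `j` over the cells of `F`. Summing over `i ∈ F` gives `c j ≤
  -- 1`, as the exponential bound requires; summing over `j` first gives total mass at most
  -- `F.card`.
  let c : ℤ × ℤ → ℝ := fun j => (∑ i ∈ F, cellWeight l s (i - j)) / W
  have hc0 : ∀ j, 0 ≤ c j := fun j => div_nonneg (Finset.sum_nonneg fun i _ => hw0 _) hWpos.le
  have hc1 : ∀ j, c j ≤ 1 := fun j => (div_le_one hWpos).2 (hrow j)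
  have hcsum : ∀ J : Finset (ℤ × ℤ), ∑ j ∈ J, c j ≤ F.card := fun J => by
    simp only [c]
    rw [← Finset.sum_div, div_le_iff₀ hWpos, Finset.sum_comm, ← nsmul_eq_mul]
    exact Finset.sum_le_card_nsmul _ _ _ fun i _ => hcol J i
  -- The order concerns finitely many cells, so the series is truncated to `J`; these events
  -- increase with `J` and the bound is uniform in `J`.
  let E : Finset (ℤ × ℤ) → Set Ω := fun J =>
    {ω | ENNReal.ofReal (F.card * M) < ∑ j ∈ J, ENNReal.ofReal (c j) * Φ ω (cell s j)}
  have hE : ∀ J ω, ω ∈ E J ↔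
      ENNReal.ofReal (F.card * M) < ∑ j ∈ J, ENNReal.ofReal (c j) * Φ ω (cell s j) :=
    fun _ _ => Iff.rfl
  have hsub : {ω | ∀ i ∈ F, ENNReal.ofReal (W * M) < cellInterference l s (Φ ω) i} ⊆
      ⋃ J, E J := by
    intro ω hω
    have h1 : F.card • ENNReal.ofReal (W * M) < ∑ i ∈ F, cellInterference l s (Φ ω) i := by
      rw [← Finset.sum_const]
      exact ENNReal.sum_lt_sum_of_nonempty hF hω
    have h2 : ∑ i ∈ F, cellInterference l s (Φ ω) i =
        ENNReal.ofReal W * ∑' j, ENNReal.ofReal (c j) * Φ ω (cell s j) := by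
      simp only [cellInterference]
      rw [← Summable.tsum_finsetSum fun i _ => ENNReal.summable, ← ENNReal.tsum_mul_left]
      refine tsum_congr fun j => ?_
      rw [← mul_assoc, ← ENNReal.ofReal_mul hWpos.le, mul_div_cancel₀ _ hWpos.ne',
        ENNReal.ofReal_sum_of_nonneg fun i _ => hw0 _, Finset.sum_mul]
    rw [h2, nsmul_eq_mul, ENNReal.ofReal_mul hWpos.le, mul_left_comm,
      ENNReal.mul_lt_mul_iff_right (by simpa using hWpos) ENNReal.ofReal_ne_top,
      ENNReal.tsum_eq_iSup_sum, lt_iSup_iff] at h1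
    obtain ⟨J, hJ⟩ := h1
    refine Set.mem_iUnion.2 ⟨J, ?_⟩
    rwa [hE, ENNReal.ofReal_mul (by positivity), ENNReal.ofReal_natCast]
  have hdir : Directed (· ⊆ ·) E := by
    classical
    intro J J'
    refine ⟨J ∪ J', fun ω hω => (hE _ _).2 (((hE _ _).1 hω).trans_le ?_),
      fun ω hω => (hE _ _).2 (((hE _ _).1 hω).trans_le ?_)⟩
    · exact Finset.sum_le_sum_of_subset Finset.subset_union_left
    · exact Finset.sum_le_sum_of_subset Finset.subset_union_right
  refine (measure_mono hsub).trans ?_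
  rw [hdir.measure_iUnion]
  refine iSup_le fun J => ?_
  let e := J.equivFin
  have hmain := measure_lt_sum_le hΦ hΦ' hle hmean (fun a => cell s (e.symm a))
    (fun a => measurableSet_cell s _) (fun a => isBounded_cell hs _)
    (fun a b hab => pairwise_disjoint_cell s fun h => hab (e.symm.injective (Subtype.ext h)))
    (fun a => c (e.symm a)) (fun a => hc0 _) (fun a => hc1 _) (F.card * M)
  have hre : ∀ g : ℤ × ℤ → ℝ, ∑ a, g (e.symm a) = ∑ j ∈ J, g j := fun g => by
    rw [e.symm.sum_comp (fun j : J => g j), Finset.sum_coe_sort J g]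
  refine (measure_mono fun ω hω => ?_).trans (hmain.trans (ENNReal.ofReal_le_ofReal ?_))
  · rw [Set.mem_ofPred_eq, hre fun j => c j * (Φ ω (cell s j)).toReal]
    have hω' := (hE _ _).1 hω
    have hfin : ∀ j, Φ ω (cell s j) ≠ ∞ := fun j => by
      obtain ⟨k, hk⟩ := hΦ.count_nat ω _ (measurableSet_cell s j) (isBounded_cell hs j)
      simp [hk]
    have heq : ∑ j ∈ J, ENNReal.ofReal (c j) * Φ ω (cell s j) =
        ENNReal.ofReal (∑ j ∈ J, c j * (Φ ω (cell s j)).toReal) := by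
      rw [ENNReal.ofReal_sum_of_nonneg fun j _ => mul_nonneg (hc0 j) ENNReal.toReal_nonneg]
      refine Finset.sum_congr rfl fun j _ => ?_
      rw [ENNReal.ofReal_mul (hc0 j), ENNReal.ofReal_toReal (hfin j)]
    rw [heq] at hω'
    exact (ENNReal.ofReal_lt_ofReal_iff_of_nonneg (by positivity)).1 hω'
  · rw [Real.exp_le_exp, hre fun j => c j * (volume (cell s j)).toReal]
    simp only [volume_cell hs, ENNReal.toReal_ofReal (sq_nonneg s)]
    rw [← Finset.sum_mul]
    have h1 := mul_le_mul_of_nonneg_right (hcsum J) (sq_nonneg s)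
    have h2 := mul_le_mul_of_nonneg_left h1 (mul_nonneg zero_le_two mu.coe_nonneg)
    linarith

end PointProcess

/-! ### Percolation of the SINR graph -/

/-- No independence is needed: for each of the `2 ^ F.card` splittings, `A` or `F \ A` has at least
half the indices. The exponent `2 * F.card` in the hypotheses compensates for keeping only that
half. -/
theorem measure_forall_or_le {Ω ι : Type*} [MeasurableSpace Ω] (Pr : Measure Ω)
    (U V : Ω → ι → Prop)
    (hU : ∀ F : Finset ι, Pr {ω | ∀ i ∈ F, U ω i} ≤ (36 : ℝ≥0∞)⁻¹ ^ (2 * F.card))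
    (hV : ∀ F : Finset ι, Pr {ω | ∀ i ∈ F, V ω i} ≤ (36 : ℝ≥0∞)⁻¹ ^ (2 * F.card))
    (F : Finset ι) : Pr {ω | ∀ i ∈ F, U ω i ∨ V ω i} ≤ (18 : ℝ≥0∞)⁻¹ ^ F.card := by
  classical
  have hsub : {ω | ∀ i ∈ F, U ω i ∨ V ω i} ⊆
      ⋃ A ∈ F.powerset, {ω | (∀ i ∈ A, U ω i) ∧ ∀ i ∈ F \ A, V ω i} := by
    intro ω hω
    refine Set.mem_biUnion (x := F.filter (U ω)) (Finset.mem_powerset.2 (Finset.filter_subset _ _))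
      ⟨fun i hi => (Finset.mem_filter.1 hi).2, fun i hi => ?_⟩
    rw [Finset.mem_sdiff, Finset.mem_filter] at hi
    exact (hω i hi.1).resolve_left fun h => hi.2 ⟨hi.1, h⟩
  have hterm : ∀ A ∈ F.powerset, Pr {ω | (∀ i ∈ A, U ω i) ∧ ∀ i ∈ F \ A, V ω i} ≤
      (36 : ℝ≥0∞)⁻¹ ^ F.card := by
    intro A hA
    have hcard := Finset.card_sdiff_add_card_eq_card (Finset.mem_powerset.1 hA)
    rcases le_total F.card (2 * A.card) with h | h
    · exact (measure_mono fun ω hω => hω.1).trans ((hU A).trans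
        (pow_le_pow_right_of_le_one' (by simp) h))
    · exact (measure_mono fun ω hω => hω.2).trans ((hV (F \ A)).trans
        (pow_le_pow_right_of_le_one' (by simp) (by omega)))
  refine (measure_mono hsub).trans ((measure_biUnion_finset_le _ _).trans
    ((Finset.sum_le_card_nsmul _ _ _ hterm).trans (le_of_eq ?_)))
  rw [Finset.card_powerset, nsmul_eq_mul, Nat.cast_pow, ← mul_pow]
  congr 1
  rw [show (36 : ℝ≥0∞) = 2 * 18 by norm_num, ENNReal.mul_inv (by simp) (by simp), ← mul_assoc]
  push_cast
  rw [ENNReal.mul_inv_cancel (by simp) (by simp), one_mul]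

/-- The signal is at least `4TN`; `γ` is chosen so that interference adds at most another `N` to the
noise, leaving a ratio of at least `2T`. -/
theorem lt_sinr {l : ℝ → ℝ} (hl : AntitoneOn l (Set.Ici 0)) {s : ℝ} (hs : 0 < s)
    (hls : 0 < l (4 * s)) {N T K : ℝ} (hN : 0 < N) (hT : 0 < T) (hK : 0 < K) (ν : Measure Plane)
    {i j : ℤ × ℤ} (hij : KingAdj i j) {x y : Plane} (hx : x ∈ cell s i) (hy : y ∈ cell s j)
    (hI : cellInterference l s ν j ≤ ENNReal.ofReal K) :
    ENNReal.ofReal T <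
      sinr l (4 * T * N / l (4 * s)) N (N / (4 * T * N / l (4 * s) * K)) ν x y := by
  have hP : 0 < 4 * T * N / l (4 * s) := by positivity
  set P := 4 * T * N / l (4 * s) with hPdef
  have hnum : 4 * T * N ≤ P * l (dist x y) := by
    have h : l (4 * s) ≤ l (dist x y) :=
      hl dist_nonneg (Set.mem_Ici.2 (by positivity)) (dist_le_of_mem_cell hs hij hx hy)
    calc 4 * T * N = P * l (4 * s) := by rw [hPdef]; field_simp
      _ ≤ P * l (dist x y) := mul_le_mul_of_nonneg_left h hP.le
  have hden : ENNReal.ofReal N + ENNReal.ofReal (N / (P * K) * P) *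
      interference l (ν.restrict {x}ᶜ) y ≤ ENNReal.ofReal (2 * N) := by
    have h := (interference_le_cellInterference hl hs ν x hy).trans hI
    refine (add_le_add_right (mul_le_mul_right h _) _).trans (le_of_eq ?_)
    rw [← ENNReal.ofReal_mul (by positivity), ← ENNReal.ofReal_add hN.le (by positivity)]
    congr 1
    field_simp
    ring
  calc ENNReal.ofReal T < ENNReal.ofReal (2 * T) :=
        (ENNReal.ofReal_lt_ofReal_iff (by positivity)).2 (by linarith)
    _ = ENNReal.ofReal (4 * T * N) / ENNReal.ofReal (2 * N) := by
        rw [← ENNReal.ofReal_div_of_pos (by positivity)]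
        congr 1
        field_simp
        ring
    _ ≤ _ := ENNReal.div_le_div (ENNReal.ofReal_le_ofReal hnum) hden

theorem LatticeAdj.kingAdj {i j : ℤ × ℤ} (h : LatticeAdj i j) : KingAdj i j ∧ KingAdj j i := by
  unfold LatticeAdj at h
  unfold KingAdj
  omega

/-- An infinite cluster of cells that contain a node and have small interference makes the SINR
graph percolate. -/
theorem percolates_of_infinite_cluster {l : ℝ → ℝ} (hl : AntitoneOn l (Set.Ici 0)) {s : ℝ}
    (hs : 0 < s) (hls : 0 < l (4 * s)) {N T K : ℝ} (hN : 0 < N) (hT : 0 < T) (hK : 0 < K)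
    {β ν : Measure Plane}
    (hβ : ∀ B : Set Plane, MeasurableSet B → Bornology.IsBounded B → ∃ k : ℕ, β B = k)
    {G : ℤ × ℤ → Prop} (hG : ∀ i, G i → β (cell s i) ≠ 0 ∧
      cellInterference l s ν i ≤ ENNReal.ofReal K)
    {a : ℤ × ℤ} (ha : G a) (hinf : {b | (siteGraph G).Reachable a b}.Infinite) :
    Percolates (sinrGraph l (4 * T * N / l (4 * s)) N T (N / (4 * T * N / l (4 * s) * K)) β ν) := by
  have hnode : ∀ i, G i → ∃ v : {x : Plane // β {x} ≠ 0}, (v : Plane) ∈ cell s i := by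
    intro i hi
    obtain ⟨x, hx, hx0⟩ := exists_atom hβ (measurableSet_cell s i) (isBounded_cell hs i) (hG i hi).1
    exact ⟨⟨x, hx0⟩, hx⟩
  have : Nonempty {x : Plane // β {x} ≠ 0} := ⟨(hnode a ha).choose⟩
  choose! f hf using hnode
  let H := sinrGraph l (4 * T * N / l (4 * s)) N T (N / (4 * T * N / l (4 * s) * K)) β ν
  have hcell : ∀ i, G i → cellIndex s (f i) = i := fun i hi => hf i hi
  have hadj : ∀ i j, G i → G j → LatticeAdj i j → H.Adj (f i) (f j) := by
    intro i j hi hj hij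
    refine ⟨fun h => ?_, lt_sinr hl hs hls hN hT hK ν hij.kingAdj.2 (hf j hj) (hf i hi) (hG i hi).2,
      lt_sinr hl hs hls hN hT hK ν hij.kingAdj.1 (hf i hi) (hf j hj) (hG j hj).2⟩
    have hij' : i = j := by rw [← hcell i hi, ← hcell j hj, h]
    subst hij'
    simp only [LatticeAdj] at hij
    omega
  have hreach : ∀ {i j}, (siteGraph G).Walk i j → H.Reachable (f i) (f j) := by
    intro i j w
    induction w with
    | nil => exact SimpleGraph.Reachable.refl _
    | cons h w ih => exact (hadj _ _ h.1 h.2.1 h.2.2).reachable.trans ih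
  refine ⟨H.connectedComponentMk (f a), ?_⟩
  -- A chosen node determines its cell, so infinitely many cells give infinitely many nodes.
  have hinj : Set.InjOn f {b | (siteGraph G).Reachable a b} := by
    intro b hb c hc hbc
    rw [← hcell b (mem_of_siteGraph_reachable ha hb), hbc,
      hcell c (mem_of_siteGraph_reachable ha hc)]
  refine (hinf.image hinj).mono ?_
  rintro _ ⟨b, hb, rfl⟩
  obtain ⟨w⟩ := hb
  exact SimpleGraph.ConnectedComponent.sound (hreach w).symm

theorem proposition3
    {Ω Ω₁ Ω₂ : Type*} [MeasurableSpace Ω] [MeasurableSpace Ω₁] [MeasurableSpace Ω₂]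
    (Pr : Measure Ω) [IsProbabilityMeasure Pr]
    (Pr₁ : Measure Ω₁) [IsProbabilityMeasure Pr₁]
    (Pr₂ : Measure Ω₂) [IsProbabilityMeasure Pr₂]
    -- noise, threshold and attenuation function
    (N T : ℝ) (hN : 0 < N) (hT : 0 < T)
    (l : ℝ → ℝ) (hl : IsAttenuation l) (hl_pos : ∀ r, 0 ≤ r → 0 < l r)
    -- back-bone and interferers, on one probability space, with any dependence
    (ΦB ΦI : Ω → Measure Plane) (hB : IsPointProcess ΦB) (hI : IsPointProcess ΦI)
    -- homogeneous Poisson processes of intensities `lam` and `mu`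
    (lam mu : ℝ≥0) (hlam : 0 < lam) (hmu : 0 < mu)
    (Φlam : Ω₁ → Measure Plane) (hΦlam : IsPoissonProcess Pr₁ Φlam lam)
    (Φmu : Ω₂ → Measure Plane) (hΦmu : IsPoissonProcess Pr₂ Φmu mu)
    (hB_le : PPLeDdcx Pr ΦB Pr₁ Φlam)
    (hI_le : PPLeIdcx Pr ΦI Pr₂ Φmu)
    -- the mean measure of the interferers is locally finite
    (hI_mean : ∀ B : Set Plane, MeasurableSet B → Bornology.IsBounded B →
      ∫⁻ ω, ΦI ω B ∂Pr < ∞) :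
    ∃ P γ : ℝ, 0 < P ∧ 0 < γ ∧ T * N / P ≤ l 0 ∧
      ∀ᵐ ω ∂Pr, Percolates (sinrGraph l P N T γ (ΦB ω) (ΦI ω)) := by
  have hanti := hl.antitoneOn hl_pos
  have hc : 0 < Real.log 1296 := Real.log_pos (by norm_num)
  have hlam' : (0 : ℝ) < lam := hlam
  -- Since `1296 = 36 ^ 2`, `k` cells of this size are empty with probability at most `36 ^ (-2k)`.
  obtain ⟨s, hs, hs2⟩ : ∃ s : ℝ, 0 < s ∧ lam * s ^ 2 = Real.log 1296 := by
    refine ⟨√(Real.log 1296 / lam), Real.sqrt_pos.2 (by positivity), ?_⟩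
    rw [Real.sq_sqrt (by positivity)]
    field_simp
  have hexp : ∀ k : ℕ, ENNReal.ofReal (Real.exp (-(k * Real.log 1296))) =
      (36 : ℝ≥0∞)⁻¹ ^ (2 * k) := by
    intro k
    rw [← mul_neg, Real.exp_nat_mul, Real.exp_neg, Real.exp_log (by norm_num),
      ENNReal.ofReal_pow (by norm_num), ENNReal.ofReal_inv_of_pos (by norm_num), pow_mul]
    congr 1
    rw [← ENNReal.inv_pow]
    norm_num
  have hsum := summable_cellWeight hl hanti hs
  have hWpos : 0 < ∑' k, cellWeight l s k :=
    hsum.tsum_pos (cellWeight_nonneg hl s) 0 (hl_pos _ (le_max_left _ _))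
  -- The summand `1` in `1 + log 1296` absorbs the additive `1` in the exponent of the
  -- large-deviation bound, as `F.card ≥ 1`.
  obtain ⟨M, hMdef⟩ : ∃ M : ℝ, M = 2 * mu * s ^ 2 + (1 + Real.log 1296) := ⟨_, rfl⟩
  have hM : 0 < M := by rw [hMdef]; positivity
  have hK : 0 < (∑' k, cellWeight l s k) * M := mul_pos hWpos hM
  have hls : 0 < l (4 * s) := hl_pos _ (by positivity)
  have hP : 0 < 4 * T * N / l (4 * s) := by positivity
  have hU : ∀ F : Finset (ℤ × ℤ), Pr {ω | ∀ i ∈ F, ΦB ω (cell s i) = 0} ≤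
      (36 : ℝ≥0∞)⁻¹ ^ (2 * F.card) := by
    intro F
    have h := measure_void_le hB hΦlam hB_le
      (F.measurableSet_biUnion fun i _ => measurableSet_cell s i)
      ((Bornology.isBounded_biUnion_finset F).2 fun i _ => isBounded_cell hs i)
    rw [volume_biUnion_cell hs, ENNReal.toReal_ofReal (by positivity), mul_left_comm, hs2,
      hexp] at h
    refine (measure_mono fun ω hω => ?_).trans h
    exact (measure_biUnion_null_iff F.countable_toSet).2 hω
  have hV : ∀ F : Finset (ℤ × ℤ), Pr {ω | ∀ i ∈ F,
      ENNReal.ofReal ((∑' k, cellWeight l s k) * M) < cellInterference l s (ΦI ω) i} ≤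
      (36 : ℝ≥0∞)⁻¹ ^ (2 * F.card) := by
    intro F
    rcases F.eq_empty_or_nonempty with rfl | hF
    · simp
    refine (measure_forall_lt_cellInterference_le hI hΦmu hI_le hI_mean hl hl_pos hs hM.le hF).trans
      ((ENNReal.ofReal_le_ofReal (Real.exp_le_exp.2 ?_)).trans (hexp F.card).le)
    have h1 : (1 : ℝ) ≤ F.card := by exact_mod_cast hF.card_pos
    rw [hMdef]
    linarith
  refine ⟨4 * T * N / l (4 * s),
    N / (4 * T * N / l (4 * s) * ((∑' k, cellWeight l s k) * M)), hP, by positivity, ?_, ?_⟩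
  -- For this power `T * N / P` is `l (4 * s) / 4`, so monotonicity suffices.
  · have h0 : l (4 * s) ≤ l 0 :=
      hanti (Set.mem_Ici.2 le_rfl) (Set.mem_Ici.2 (by positivity)) (by positivity)
    have h1 : T * N / (4 * T * N / l (4 * s)) = l (4 * s) / 4 := by field_simp
    rw [h1]
    linarith
  · filter_upwards [ae_exists_infinite_cluster Pr _ (measure_forall_or_le Pr _ _ hU hV)]
      with ω hω
    obtain ⟨a, ha, hinf⟩ := hω
    refine percolates_of_infinite_cluster hanti hs hls hN hT hK (hB.count_nat ω)
      (fun i hi => ?_) ha hinf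
    exact ⟨fun h => hi (Or.inl h), not_lt.1 fun h => hi (Or.inr h)⟩
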